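/- **Conventions.** For a C$^*$-algebra $\mathcal A$ let $\mathcal A^\sim$ denote its unitization: $\mathcal A^\sim=\mathbb C\oplus\mathcal A$; if $\mathcal A$ is unital one may also take $\mathcal A^\sim=\mathcal A$, and the statement below holds for both choices. $K_0(\mathcal A)$ is the Grothendieck group of homotopy classes of projections in matrix algebras over $\mathcal A$ if $\mathcal A$ is unital, and in general the kernel of $K_0(\mathbb C\oplus\mathcal A)\to K_0(\mathbb C)$; $K_1(\mathcal A)$ is the group of stable homotopy classes of invertibles in matrix algebras over $\mathcal A^\sim$. A selfadjoint invertible $h\in M_n(\mathcal A^\sim)$ with positive spectral projection $p=\chi(h>0)$ defines $[h]_0=[p]-[s(p)]\in K_0(\mathcal A)$, where $s(p)$ is the scalar part of $p$ when $\mathcal A^\sim=\mathbb C\oplus\mathcal A$ (if $\mathcal A^\sim=\mathcal A$ is unital, $[h]_0=[p]$). If $h$ moreover anticommutes with ${\bf 1}\otimes\Gamma$ for a symmetry $\Gamma=\Gamma^*=\Gamma^{-1}\in M_n(\mathbb C)$, then in an orthonormal eigenbasis of $\Gamma$ with $\Gamma=\mathrm{diag}(1,-1)$ one has $h=\begin{pmatrix}0&x\\x^*&0\end{pmatrix}$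 with $x$ invertible, and $[h]_1=[x]\in K_1(\mathcal A)$. Invertible $A_1,\dots,A_d\in\mathcal A^\sim$ form a *fuzzy $d$-torus of width $\delta\in[0,1)$* if $\|A_jA_j^*-{\bf 1}\|\le\delta$, $\|A_j^*A_j-{\bf 1}\|\le\delta$ and $\|[A_j,A_i]\|\le\delta$ for all $i,j$. A fuzzy $(d+1)$-torus $A_1,\dots,A_{d+1}$ of width $\delta$ with $A_{d+1}=A_{d+1}^*$ is a *graded fuzzy $d$-torus of width $\delta$*. For $I=\{i_1<\dots<i_{|I|}\}\subset\{1,\dots,d\}$ and an irreducible selfadjoint representation $\gamma_1,\dots,\gamma_{|I|+1}$ on $\mathbb C^n$ of the Clifford algebra with $|I|+1$ generators put $$G_I=\sum_{j=1}^{|I|}\Im m(A_{i_j})\otimes\gamma_j+\Big((|I|-1){\bf 1}-\sum_{j=1}^{|I|}\Re e(A_{i_j})\Big)\otimes\gamma_{|I|+1},$$ $$\widehat G_I=\sum_{j=1}^{|I|}\Im m(A_{i_j})\otimes\gamma_j+\Big(|I|{\bf 1}-\sum_{j=1}^{|I|}\Re e(A_{i_j})-A_{d+1}\Big)\otimes\gamma_{|I|+1}.$$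 For a graded torus let $P$ be the Riesz projection of $A_{d+1}$ on its positive spectrum, and let $G^P_I$ be the operator $G_I$ of $PA_1P,\dots,PA_dP$ in $P\mathcal A^\sim P$ (with unit $P$). **Corollary.** For every $d$ there is $\delta_0>0$, depending only on $d$, such that for every $\delta\le\delta_0$, every C$^*$-algebra $\mathcal A$, every $I\subset\{1,\dots,d\}$ and every irreducible selfadjoint representation $\gamma$ as above the following hold. 1. Let $A_1,\dots,A_d\in\mathcal A^\sim$ be a fuzzy $d$-torus of width $\delta$. If $|I|$ is even, then $G_I$ is selfadjoint and invertible and hence defines a unique class $[G_I]_0\in K_0(\mathcal A)$. If $|I|$ is odd, then there is a further Clifford generator $\Gamma$ on $\mathbb C^n$, that is, a selfadjoint unitary anticommuting with all $\gamma_j$, and for each such $\Gamma$ the operator $G_I$ is selfadjoint, invertible and anticommutes with ${\bf 1}\otimes\Gamma$, and hence defines a class $[G_I]_1\in K_1(\mathcal A)$ that does not depend on the choice of the eigenbasis of $\Gamma$. 2. Let $A_1,\dots,A_{d+1}\in\mathcal A^\sim$ be a graded fuzzy $d$-torus of width $\delta$. In the same sense $\widehat G_I$ defines a class $[\widehat G_I]_0\in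 K_0(\mathcal A)$ if $|I|$ is even and $[\widehat G_I]_1\in K_1(\mathcal A)$ if $|I|$ is odd. Moreover, $P$ is a projection, $PA_1P,\dots,PA_dP$ is a fuzzy $d$-torus of width $6\delta$ in $P\mathcal A^\sim P$, and these classes are also represented by the operators $G^P_I$, completed by $({\bf 1}-P)\otimes\gamma_{|I|+1}$ on the complement of $P$: $$[\widehat G_I]_0=[G^P_I\oplus({\bf 1}-P)\otimes\gamma_{|I|+1}]_0\ \ (|I|\text{ even}),\qquad[\widehat G_I]_1=[G^P_I\oplus({\bf 1}-P)\otimes\gamma_{|I|+1}]_1\ \ (|I|\text{ odd}).$$ -/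

import Mathlib

universe u

noncomputable section

open scoped Matrix

namespace FuzzyTorus

/-! ## Spectral projections and matrices over a unital C⋆-algebra -/

section Spectral

attribute [local instance] CStarAlgebra.spectralOrder CStarAlgebra.spectralOrderedRing

/-- The spectral projection `χ(h > 0)`, obtained by continuous functional calculus.  It is used
only for selfadjoint invertible `h`, where `χ(· > 0)` is continuous on the spectrum; it is then
the Riesz projection of `h` on its positive spectrum. -/
def posProj {B : Type*} [CStarAlgebra B] (h : B) : B :=
  cfc (Set.indicator (Set.Ioi (0 : ℝ)) (fun _ => (1 : ℝ))) h

/-- `χ(h > 0)` for a matrix `h` over a C⋆-algebra. -/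
def matPosProj {E : Type*} [CStarAlgebra E] {n : ℕ} (h : CStarMatrix (Fin n) (Fin n) E) :
    CStarMatrix (Fin n) (Fin n) E :=
  posProj h

end Spectral

section Matrices

variable {E : Type*} [CStarAlgebra E]

/-- The block sum `diag(a, b)` of two square matrices over `E`. -/
def dsum {m n : ℕ} (a : CStarMatrix (Fin m) (Fin m) E) (b : CStarMatrix (Fin n) (Fin n) E) :
    CStarMatrix (Fin (m + n)) (Fin (m + n)) E :=
  CStarMatrix.ofMatrix
    ((Matrix.fromBlocks (CStarMatrix.ofMatrix.symm a) 0 0 (CStarMatrix.ofMatrix.symm b)).submatrix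
      finSumFinEquiv.symm finSumFinEquiv.symm)

/-- A complex matrix viewed as a matrix over `E`. -/
def scal (E : Type*) [CStarAlgebra E] {m n : ℕ} (M : Matrix (Fin m) (Fin n) ℂ) :
    CStarMatrix (Fin m) (Fin n) E :=
  CStarMatrix.ofMatrix (M.map (algebraMap ℂ E))

/-- The elementary tensor `a ⊗ γ` in `E ⊗ Mₙ(ℂ) = Mₙ(E)`. -/
def tens {n : ℕ} (a : E) (γ : Matrix (Fin n) (Fin n) ℂ) : CStarMatrix (Fin n) (Fin n) E :=
  CStarMatrix.ofMatrix (γ.map fun z => z • a)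

end Matrices

/-! ## K-theory of C⋆-algebras -/

section KTheory

/-- Projections in the matrix algebras `Mₙ(E)`, `n ∈ ℕ`. -/
abbrev MatProj (E : Type*) [CStarAlgebra E] : Type _ :=
  Σ n : ℕ, {p : CStarMatrix (Fin n) (Fin n) E // IsStarProjection p}

/-- Invertibles in the matrix algebras `Mₙ(E)`, `n ∈ ℕ`. -/
abbrev MatInv (E : Type*) [CStarAlgebra E] : Type _ :=
  Σ n : ℕ, {x : CStarMatrix (Fin n) (Fin n) E // IsUnit x}

/-- Defining relations of `K₀` of a unital C⋆-algebra: block sums are sums, homotopic projections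
are equal, zero projections vanish. -/
inductive K0Rel (E : Type*) [CStarAlgebra E] : FreeAbelianGroup (MatProj E) → Prop
  | sum {m n : ℕ} (p : {p : CStarMatrix (Fin m) (Fin m) E // IsStarProjection p})
      (q : {p : CStarMatrix (Fin n) (Fin n) E // IsStarProjection p})
      (r : {p : CStarMatrix (Fin (m + n)) (Fin (m + n)) E // IsStarProjection p})
      (h : r.1 = dsum p.1 q.1) :
      K0Rel E (FreeAbelianGroup.of ⟨m + n, r⟩ - FreeAbelianGroup.of ⟨m, p⟩
        - FreeAbelianGroup.of ⟨n, q⟩)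
  | homotopy {n : ℕ} (p q : {p : CStarMatrix (Fin n) (Fin n) E // IsStarProjection p})
      (h : JoinedIn {x : CStarMatrix (Fin n) (Fin n) E | IsStarProjection x} p.1 q.1) :
      K0Rel E (FreeAbelianGroup.of ⟨n, p⟩ - FreeAbelianGroup.of ⟨n, q⟩)
  | zero {n : ℕ} (p : {p : CStarMatrix (Fin n) (Fin n) E // IsStarProjection p}) (h : p.1 = 0) :
      K0Rel E (FreeAbelianGroup.of ⟨n, p⟩)

/-- `K₀(E)` of a unital C⋆-algebra `E`: the Grothendieck group of homotopy classes of projections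
in matrix algebras over `E`, by generators and relations. -/
abbrev K0Unital (E : Type*) [CStarAlgebra E] : Type _ :=
  FreeAbelianGroup (MatProj E) ⧸ AddSubgroup.closure {x | K0Rel E x}

/-- The class of a projection in `K₀(E)`. -/
def K0Unital.mk {E : Type*} [CStarAlgebra E] {n : ℕ} (p : CStarMatrix (Fin n) (Fin n) E)
    (hp : IsStarProjection p) : K0Unital E :=
  QuotientAddGroup.mk (FreeAbelianGroup.of (⟨n, p, hp⟩ : MatProj E))

/-- Defining relations of `K₁` of a unital C⋆-algebra: block sums are sums, homotopic invertibles
are equal, identity matrices vanish. -/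
inductive K1Rel (E : Type*) [CStarAlgebra E] : FreeAbelianGroup (MatInv E) → Prop
  | sum {m n : ℕ} (p : {p : CStarMatrix (Fin m) (Fin m) E // IsUnit p})
      (q : {p : CStarMatrix (Fin n) (Fin n) E // IsUnit p})
      (r : {p : CStarMatrix (Fin (m + n)) (Fin (m + n)) E // IsUnit p})
      (h : r.1 = dsum p.1 q.1) :
      K1Rel E (FreeAbelianGroup.of ⟨m + n, r⟩ - FreeAbelianGroup.of ⟨m, p⟩
        - FreeAbelianGroup.of ⟨n, q⟩)
  | homotopy {n : ℕ} (p q : {p : CStarMatrix (Fin n) (Fin n) E // IsUnit p})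
      (h : JoinedIn {x : CStarMatrix (Fin n) (Fin n) E | IsUnit x} p.1 q.1) :
      K1Rel E (FreeAbelianGroup.of ⟨n, p⟩ - FreeAbelianGroup.of ⟨n, q⟩)
  | one {n : ℕ} (p : {p : CStarMatrix (Fin n) (Fin n) E // IsUnit p}) (h : p.1 = 1) :
      K1Rel E (FreeAbelianGroup.of ⟨n, p⟩)

/-- `K₁(E)` of a unital C⋆-algebra `E`: stable homotopy classes of invertibles in matrix algebras
over `E`, by generators and relations. -/
abbrev K1Unital (E : Type*) [CStarAlgebra E] : Type _ :=
  FreeAbelianGroup (MatInv E) ⧸ AddSubgroup.closure {x | K1Rel E x}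

/-- The class of an invertible matrix in `K₁(E)`. -/
def K1Unital.mk {E : Type*} [CStarAlgebra E] {n : ℕ} (x : CStarMatrix (Fin n) (Fin n) E)
    (hx : IsUnit x) : K1Unital E :=
  QuotientAddGroup.mk (FreeAbelianGroup.of (⟨n, x, hx⟩ : MatInv E))

variable {E F : Type*} [CStarAlgebra E] [CStarAlgebra F]

theorem map_dsum (φ : E →⋆ₐ[ℂ] F) {m n : ℕ} (a : CStarMatrix (Fin m) (Fin m) E)
    (b : CStarMatrix (Fin n) (Fin n) E) : (dsum a b).map φ = dsum (a.map φ) (b.map φ) := by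
  ext i j
  refine Fin.addCases (fun i => ?_) (fun i => ?_) i <;>
    refine Fin.addCases (fun j => ?_) (fun j => ?_) j <;>
    simp [dsum, CStarMatrix.ofMatrix_apply]

theorem map_isStarProjection (φ : E →⋆ₐ[ℂ] F) {n : ℕ} {p : CStarMatrix (Fin n) (Fin n) E}
    (hp : IsStarProjection p) : IsStarProjection (p.map φ) := by
  refine ⟨?_, ?_⟩
  · have h := hp.isIdempotentElem
    rw [IsIdempotentElem] at h ⊢
    ext i j
    rw [CStarMatrix.mul_apply]
    conv_rhs => rw [← h]
    simp [CStarMatrix.mul_apply]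
  · have h := hp.isSelfAdjoint
    rw [isSelfAdjoint_iff] at h ⊢
    ext i j
    conv_rhs => rw [← h]
    simp [CStarMatrix.star_apply, map_star]

theorem continuous_map (φ : E →⋆ₐ[ℂ] F) (n : ℕ) :
    Continuous (fun p : CStarMatrix (Fin n) (Fin n) E => p.map φ) :=
  Continuous.matrix_map (A := fun p : Matrix (Fin n) (Fin n) E => p) continuous_id
    (AddMonoidHomClass.continuous_of_bound φ 1 fun a => by
      simpa using NonUnitalStarAlgHom.norm_apply_le φ a)

/-- The image of a matrix projection under a unital ⋆-homomorphism. -/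
def MatProj.map (φ : E →⋆ₐ[ℂ] F) (x : MatProj E) : MatProj F :=
  ⟨x.1, x.2.1.map φ, map_isStarProjection φ x.2.2⟩

theorem K0Rel.map (φ : E →⋆ₐ[ℂ] F) {x : FreeAbelianGroup (MatProj E)} (hx : K0Rel E x) :
    K0Rel F (FreeAbelianGroup.map (MatProj.map φ) x) := by
  cases hx with
  | @sum m n p q r h =>
    simp only [map_sub, FreeAbelianGroup.map_of_apply]
    exact K0Rel.sum ⟨p.1.map φ, map_isStarProjection φ p.2⟩
      ⟨q.1.map φ, map_isStarProjection φ q.2⟩ ⟨r.1.map φ, map_isStarProjection φ r.2⟩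
      (by simp only [h, map_dsum])
  | @homotopy n p q h =>
    simp only [map_sub, FreeAbelianGroup.map_of_apply]
    refine K0Rel.homotopy ⟨p.1.map φ, map_isStarProjection φ p.2⟩
      ⟨q.1.map φ, map_isStarProjection φ q.2⟩ ?_
    obtain ⟨γ, hγ⟩ := h
    exact ⟨γ.map (continuous_map φ n), fun t => map_isStarProjection φ (hγ t)⟩
  | @zero n p h =>
    simp only [FreeAbelianGroup.map_of_apply]
    refine K0Rel.zero ⟨p.1.map φ, map_isStarProjection φ p.2⟩ ?_
    ext i j
    simp [h]

/-- The map `K₀(E) → K₀(F)` induced by a unital ⋆-homomorphism. -/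
def K0Unital.map (φ : E →⋆ₐ[ℂ] F) : K0Unital E →+ K0Unital F :=
  QuotientAddGroup.map _ _ (FreeAbelianGroup.map (MatProj.map φ)) <| by
    rw [AddSubgroup.closure_le]
    intro x hx
    exact AddSubgroup.subset_closure (K0Rel.map φ hx)

/-- The scalar part `A^∼ → ℂ` of the unitization `A^∼ = ℂ ⊕ A`. -/
def scalarHom (A : Type*) [NonUnitalCStarAlgebra A] : Unitization ℂ A →⋆ₐ[ℂ] ℂ :=
  { Unitization.fstHom ℂ A with map_star' := fun _ => rfl }

/-- `K₀(A)` of a (possibly non-unital) C⋆-algebra: the kernel of `K₀(A^∼) → K₀(ℂ)`. -/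
abbrev K0 (A : Type*) [NonUnitalCStarAlgebra A] : Type _ :=
  (K0Unital.map (scalarHom A)).ker

/-- `K₁(A)` of a (possibly non-unital) C⋆-algebra: `K₁(A^∼)`. -/
abbrev K1 (A : Type*) [NonUnitalCStarAlgebra A] : Type _ :=
  K1Unital (Unitization ℂ A)

/-- The matrix of scalar parts of a matrix over `A^∼`, viewed again as a matrix over `A^∼`. -/
def scalarPart {A : Type*} [NonUnitalCStarAlgebra A] {n : ℕ}
    (h : CStarMatrix (Fin n) (Fin n) (Unitization ℂ A)) :
    CStarMatrix (Fin n) (Fin n) (Unitization ℂ A) :=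
  h.map fun x => algebraMap ℂ (Unitization ℂ A) (scalarHom A x)

/-- `κ = [h]₀ ∈ K₀(E)`: `h` is a selfadjoint invertible matrix over the unital C⋆-algebra `E`, and
`κ` is the class of its positive spectral projection. -/
def IsK0UnitalClass {n : ℕ} (h : CStarMatrix (Fin n) (Fin n) E) (κ : K0Unital E) : Prop :=
  IsSelfAdjoint h ∧ IsUnit h ∧
    ∃ hp : IsStarProjection (matPosProj h), κ = K0Unital.mk (matPosProj h) hp

/-- `κ = [h]₀ ∈ K₀(A)`: `h` is a selfadjoint invertible matrix over `A^∼`, and `κ = [p] - [s(p)]`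
with `p = χ(h > 0)` and `s(p) = χ(s(h) > 0)` its scalar part (the standard picture of `K₀`). -/
def IsK0Class {A : Type*} [NonUnitalCStarAlgebra A] {n : ℕ}
    (h : CStarMatrix (Fin n) (Fin n) (Unitization ℂ A)) (κ : K0 A) : Prop :=
  IsSelfAdjoint h ∧ IsUnit h ∧
    ∃ (hp : IsStarProjection (matPosProj h)) (hs : IsStarProjection (scalarPart (matPosProj h))),
      (κ : K0Unital (Unitization ℂ A)) =
        K0Unital.mk (matPosProj h) hp - K0Unital.mk (scalarPart (matPosProj h)) hs

/-- `κ = [h]₁ ∈ K₁(E)` with respect to the symmetry `Γ` in the matrix degrees of freedom: `h` is a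
selfadjoint invertible matrix over `E` that anticommutes with `Γ`; in an orthonormal basis of
eigenvectors of `Γ` (the columns of `S` for the eigenvalue `1`, those of `T` for `-1`), where
`Γ = diag(1, -1)` and `h` is off-diagonal, the upper right entry of `h` is `x`, and `κ = [x]`. -/
def IsK1Class {n : ℕ} (Γ : Matrix (Fin n) (Fin n) ℂ) (h : CStarMatrix (Fin n) (Fin n) E)
    (κ : K1Unital E) : Prop :=
  IsSelfAdjoint h ∧ IsUnit h ∧ scal E Γ * h = -(h * scal E Γ) ∧
    ∃ (m : ℕ) (S T : Matrix (Fin n) (Fin m) ℂ) (hx : IsUnit (scal E Sᴴ * h * scal E T)),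
      Sᴴ * S = 1 ∧ Tᴴ * T = 1 ∧ S * Sᴴ + T * Tᴴ = 1 ∧ S * Sᴴ - T * Tᴴ = Γ ∧
      κ = K1Unital.mk (scal E Sᴴ * h * scal E T) hx

end KTheory

/-! ## Fuzzy tori and their `G`-operators -/

section Tori

variable {E : Type*} [CStarAlgebra E] {d n : ℕ}

/-- `T₁, …, T_d` is a fuzzy `d`-torus of width `δ` in the corner `e E e` (whose unit is the
projection `e`). -/
structure IsFuzzyTorusIn (e : E) (δ : ℝ) (T : Fin d → E) : Prop where
  width_nonneg : 0 ≤ δ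
  width_lt_one : δ < 1
  mem_corner : ∀ j, e * T j * e = T j
  invertible : ∀ j, ∃ R : E, e * R * e = R ∧ T j * R = e ∧ R * T j = e
  norm_mul_star : ∀ j, ‖T j * star (T j) - e‖ ≤ δ
  norm_star_mul : ∀ j, ‖star (T j) * T j - e‖ ≤ δ
  norm_commutator : ∀ j i, ‖T j * T i - T i * T j‖ ≤ δ

/-- `T₁, …, T_d` is a fuzzy `d`-torus of width `δ` in `E`. -/
def IsFuzzyTorus (δ : ℝ) (T : Fin d → E) : Prop :=
  IsFuzzyTorusIn 1 δ T

/-- `T₁, …, T_{d+1}` is a graded fuzzy `d`-torus of width `δ` in `E`. -/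
def IsGradedFuzzyTorus (δ : ℝ) (T : Fin (d + 1) → E) : Prop :=
  IsSelfAdjoint (T (Fin.last d)) ∧ IsFuzzyTorus δ T

/-- An irreducible selfadjoint representation on `ℂⁿ` of the Clifford algebra with `k`
generators. -/
structure IsIrreducibleClifford {k : ℕ} (γ : Fin k → Matrix (Fin n) (Fin n) ℂ) : Prop where
  isHermitian : ∀ i, (γ i).IsHermitian
  sq_eq_one : ∀ i, γ i * γ i = 1
  anticommute : ∀ i j, i ≠ j → γ i * γ j = -(γ j * γ i)
  dim_pos : 0 < n
  irreducible : ∀ W : Submodule ℂ (Fin n → ℂ),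
    (∀ i, ∀ w ∈ W, γ i *ᵥ w ∈ W) → W = ⊥ ∨ W = ⊤

/-- `Γ` is a further Clifford generator on the representation space of `γ`. -/
structure IsFurtherGenerator {k : ℕ} (γ : Fin k → Matrix (Fin n) (Fin n) ℂ)
    (Γ : Matrix (Fin n) (Fin n) ℂ) : Prop where
  isHermitian : Γ.IsHermitian
  sq_eq_one : Γ * Γ = 1
  anticommute : ∀ i, Γ * γ i = -(γ i * Γ)

/-- The operator `G_I(T₁, …, T_d)` of a torus in the corner `e E e`:
`∑_j Im(T_{i_j}) ⊗ γ_j + ((|I| - 1) e - ∑_j Re(T_{i_j})) ⊗ γ_{|I|+1}`, where `i_1 < i_2 < …` are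
the elements of `I`. For `e = 1` this is the `G`-operator of a torus in `E`. -/
def gOp (e : E) (T : Fin d → E) (I : Finset (Fin d))
    (γ : Fin (I.card + 1) → Matrix (Fin n) (Fin n) ℂ) : CStarMatrix (Fin n) (Fin n) E :=
  ∑ j : Fin I.card, tens (imaginaryPart (T (I.orderEmbOfFin rfl j)) : E) (γ j.castSucc) +
    tens (((I.card : ℂ) - 1) • e -
      ∑ j : Fin I.card, (realPart (T (I.orderEmbOfFin rfl j)) : E)) (γ (Fin.last I.card))

/-- The operator `Ĝ_I(T₁, …, T_{d+1})` of a graded torus: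
`∑_j Im(T_{i_j}) ⊗ γ_j + (|I| 1 - ∑_j Re(T_{i_j}) - T_{d+1}) ⊗ γ_{|I|+1}`. -/
def gHatOp (T : Fin (d + 1) → E) (I : Finset (Fin d))
    (γ : Fin (I.card + 1) → Matrix (Fin n) (Fin n) ℂ) : CStarMatrix (Fin n) (Fin n) E :=
  ∑ j : Fin I.card,
      tens (imaginaryPart (T (I.orderEmbOfFin rfl j).castSucc) : E) (γ j.castSucc) +
    tens ((I.card : ℂ) • (1 : E) -
      ∑ j : Fin I.card, (realPart (T (I.orderEmbOfFin rfl j).castSucc) : E) - T (Fin.last d))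
      (γ (Fin.last I.card))

/-- The projection `P` of a graded torus: the Riesz projection of `T_{d+1}` on its positive
spectrum. -/
def gradingProj (T : Fin (d + 1) → E) : E :=
  posProj (T (Fin.last d))

/-- The `P`-restricted torus `P T₁ P, …, P T_d P` of a graded torus. -/
def restrictedTorus (T : Fin (d + 1) → E) : Fin d → E :=
  fun j => gradingProj T * T j.castSucc * gradingProj T

/-- `G^P_I ⊕ (1 - P) ⊗ γ_{|I|+1}`: the `G`-operator `G^P_I = G_I(P T₁ P, …, P T_d P)` of the
restricted torus (in the corner `P E P`), completed by the trivial summand on `1 - P`. -/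
def gRestrictedOp (T : Fin (d + 1) → E) (I : Finset (Fin d))
    (γ : Fin (I.card + 1) → Matrix (Fin n) (Fin n) ℂ) : CStarMatrix (Fin n) (Fin n) E :=
  gOp (gradingProj T) (restrictedTorus T) I γ + tens (1 - gradingProj T) (γ (Fin.last I.card))

end Tori

end FuzzyTorus

end

/-! Let `S = 2P - 1`, where `P` is the positive spectral projection of `A_{d+1}`. The segment
`interpOp` from the completed restricted operator (`r = 0`) to `Ĝ_I` (`r = 1`) is again a Clifford
combination `∑ y_j ⊗ γ_j`. Once it is invertible for all `r ∈ [0,1]`, homotopy invariance identifies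
the K-classes of its ends. The ungraded statement is the case `A_{d+1} = 1`, where `Ĝ_I = G_I`.

Invertibility is first seen on an honest commutative torus, with `A_{d+1} = S`. Put `e_j = 1 - Re
A_j`, so that `(Im A_j)² = 2e_j - e_j²`. Then `∑ y_j²` equals `1 + ∑_{j≠l} e_j e_l` where `S = 1`,
and `1 + 2r(r+1) ∑ e_j + r² ∑_{j≠l} e_j e_l` where `S = -1`. Since `2e_j = (1 - A_j)⋆(1 - A_j)`, the
terms beyond `1` can be written as sums of elements `z⋆z`, a form that stays positive without
commutativity (`sum_sq_eq_one_add_excess`, `excess_nonneg`).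

The identity passes to fuzzy tori with an error `O(δ)` and a uniform constant
(`exists_norm_sum_sq_sub_le`): bounded families indexed by all fuzzy tori at once, modulo families
that are `O(δ)`, form an algebra in which the relevant elements commute and satisfy the exact
relations, so the commutative identity holds there. The same argument makes the commutators of the
`y_j` small, so the square of the operator is close to `(∑ y_j²) ⊗ 1` and hence at least `1/4` for
small `δ` (`isUnit_of_norm_mul_self_sub_le`).

On the K-theory side, `χ(· > 0)` is continuous along paths of selfadjoint invertibles. For odd
`|I|`, the off-diagonal corner stays invertible along the path, and a change of eigenbasis
multiplies it by complex unitaries, which are connected to `1` through invertible matrices. -/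

noncomputable section

open scoped Matrix

namespace FuzzyTorus

/-! ### The algebraic identity on a commutative torus -/

section Expressions

variable {X Y : Type*} [Ring X] [Algebra ℂ X] [Ring Y] [Algebra ℂ Y] {k : ℕ}

/-- `(a - b) / 2i`, the imaginary part of `a` if `b = a⋆`. -/
def imExpr (a b : X) : X := (-(Complex.I / 2)) • (a - b)

/-- `1 - (a + b) / 2`, that is `1 - Re a` if `b = a⋆`. -/
def oneSubReExpr (a b : X) : X := 1 - (1 / 2 : ℂ) • (a + b)

/-- The projection `(1 + s) / 2` on the positive eigenspace of a symmetry `s`. -/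
def posExpr (s : X) : X := (1 / 2 : ℂ) • (1 + s)

/-- The projection `(1 - s) / 2` on the negative eigenspace of a symmetry `s`. -/
def negExpr (s : X) : X := (1 / 2 : ℂ) • (1 - s)

/-- The coefficient at the `j`-th Clifford generator of the interpolated `G`-operator. -/
def sinCoeff (a b s r : X) : X :=
  r * imExpr a b + (1 - r) * (posExpr s * imExpr a b * posExpr s)

/-- The coefficient at the last Clifford generator of the interpolated `G`-operator. -/
def lastCoeff (a b : Fin k → X) (h s r : X) : X :=
  r * ∑ j, oneSubReExpr (a j) (b j) +
    (1 - r) * (posExpr s * (∑ j, oneSubReExpr (a j) (b j)) * posExpr s) - (r * h + (1 - r) * s)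

/-- The weight `p + r q` of the interpolation. -/
def weightExpr (s r : X) : X := posExpr s + r * negExpr s

/-- The positive excess over `1` of the square of the interpolated `G`-operator. -/
def excess (a b : Fin k → X) (s r : X) : X :=
  ∑ j, r * (r + 1) * (negExpr s * (1 - b j) * ((1 - a j) * negExpr s)) +
    (1 / 4 : ℂ) • ∑ j, ∑ l ∈ Finset.univ.erase j,
      weightExpr s r * (1 - b j) * (1 - b l) * ((1 - a l) * (1 - a j) * weightExpr s r)

theorem map_sinCoeff (f : X →ₐ[ℂ] Y) (a b s r : X) :
    f (sinCoeff a b s r) = sinCoeff (f a) (f b) (f s) (f r) := by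
  simp [sinCoeff, imExpr, posExpr]

theorem map_lastCoeff (f : X →ₐ[ℂ] Y) (a b : Fin k → X) (h s r : X) :
    f (lastCoeff a b h s r) =
      lastCoeff (fun j => f (a j)) (fun j => f (b j)) (f h) (f s) (f r) := by
  simp [lastCoeff, oneSubReExpr, posExpr]

theorem map_excess (f : X →ₐ[ℂ] Y) (a b : Fin k → X) (s r : X) :
    f (excess a b s r) = excess (fun j => f (a j)) (fun j => f (b j)) (f s) (f r) := by
  simp [excess, weightExpr, posExpr, negExpr]

/-- On a commutative torus the square of the interpolated `G`-operator is one plus the excess. -/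
theorem sum_sq_eq_one_add_excess {R : Type*} [CommRing R] [Algebra ℂ R] (a b : Fin k → R)
    (s r : R) (hab : ∀ j, a j * b j = 1) (hs : s * s = 1) :
    ∑ j, sinCoeff (a j) (b j) s r * sinCoeff (a j) (b j) s r +
      lastCoeff a b s s r * lastCoeff a b s s r = 1 + excess a b s r := by
  obtain ⟨p, hp⟩ : ∃ p, p = posExpr s := ⟨_, rfl⟩
  -- The scalar `1/2` becomes a ring element with `ι + ι = 1`, so that `linear_combination` can
  -- handle it.
  obtain ⟨ι, hι⟩ : ∃ ι : R, ι = algebraMap ℂ R (1 / 2) := ⟨_, rfl⟩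
  have hι2 : ι + ι = 1 := by
    rw [hι, ← map_add]; norm_num
  have hsp : s = 2 * p - 1 := by
    rw [hp, posExpr, Algebra.smul_def, ← hι]; linear_combination (-1 - s) * hι2
  have hpp : p * p = p := by
    rw [hp, posExpr, Algebra.smul_def, ← hι]
    linear_combination ι ^ 2 * hs + (ι + ι * s) * hι2
  have hq : negExpr s = 1 - p := by
    rw [hp, posExpr, negExpr, Algebra.smul_def, Algebra.smul_def, ← hι]
    linear_combination hι2
  -- In terms of `e = 1 - cos`, one has `|1 - a|² = 2e` and `sin² = 2e - e²`; everything becomes a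
  -- polynomial in `e`, `p` and `r` modulo `p² = p`.
  obtain ⟨e, he⟩ : ∃ e : Fin k → R, ∀ j, e j = oneSubReExpr (a j) (b j) := ⟨_, fun _ => rfl⟩
  have hb : ∀ j, (1 - b j) * (1 - a j) = 2 * e j := by
    intro j
    rw [he, oneSubReExpr, Algebra.smul_def, ← hι]
    linear_combination hab j + (a j + b j) * hι2
  have hsin : ∀ j, imExpr (a j) (b j) * imExpr (a j) (b j) = 2 * e j - e j * e j := by
    intro j
    have hI : algebraMap ℂ R (-(Complex.I / 2)) * algebraMap ℂ R (-(Complex.I / 2)) = -(ι * ι) := by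
      rw [hι, ← map_mul, ← map_mul, ← map_neg]; congr 1
      linear_combination (1/4) * Complex.I_mul_I
    rw [he, oneSubReExpr, imExpr, Algebra.smul_def, Algebra.smul_def, ← hι]
    linear_combination (a j - b j) ^ 2 * hI + (ι * ι * 4 : R) * hab j + (2 * ι + 1) * hι2
  have hw : weightExpr s r = p + r * (1 - p) := by rw [weightExpr, hq, hp]
  have hu : ∀ j, sinCoeff (a j) (b j) s r * sinCoeff (a j) (b j) s r =
      (p + r * (1 - p)) ^ 2 * (2 * e j - e j * e j) := by
    intro j
    have h : p * imExpr (a j) (b j) * p = imExpr (a j) (b j) * p := by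
      linear_combination imExpr (a j) (b j) * hpp
    rw [sinCoeff, ← hp, ← hsin, h]
    ring
  have h4 : ∀ x : R, (1 / 4 : ℂ) • (4 * x) = x := by
    intro x
    rw [Algebra.smul_def, ← mul_assoc, ← map_ofNat (algebraMap ℂ R) 4, ← map_mul]; norm_num
  have hx : ∀ j l, weightExpr s r * (1 - b j) * (1 - b l) *
      ((1 - a l) * (1 - a j) * weightExpr s r) = 4 * ((p + r * (1 - p)) ^ 2 * (e j * e l)) := by
    intro j l
    rw [hw]
    linear_combination (p + r * (1 - p)) ^ 2 * (1 - b l) * (1 - a l) * hb j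
      + (p + r * (1 - p)) ^ 2 * 2 * e j * hb l
  have hy : ∀ j, r * (r + 1) * (negExpr s * (1 - b j) * ((1 - a j) * negExpr s)) =
      r * (r + 1) * (1 - p) * 2 * e j := by
    intro j
    rw [hq]
    linear_combination r * (r + 1) * (1 - p) ^ 2 * hb j + r * (r + 1) * 2 * e j * hpp
  have hout : ∀ c : R, ∑ j, c * (2 * e j - e j * e j) =
      c * (2 * ∑ j, e j - ∑ j, e j * e j) := by
    intro c
    rw [← Finset.mul_sum, Finset.sum_sub_distrib, ← Finset.mul_sum]
  have hoff : ∑ j, ∑ l ∈ Finset.univ.erase j, 4 * ((p + r * (1 - p)) ^ 2 * (e j * e l)) =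
      4 * ((p + r * (1 - p)) ^ 2 * ((∑ j, e j) * ∑ j, e j - ∑ j, e j * e j)) := by
    simp only [← Finset.mul_sum, Finset.sum_erase_eq_sub (Finset.mem_univ _),
      mul_sub, Finset.sum_sub_distrib]
    simp only [← Finset.sum_mul]
  simp only [excess, lastCoeff, ← he, hu, hx, hy, ← hp]
  rw [hout, hoff, h4, ← Finset.mul_sum, hsp]
  generalize ∑ j, e j = E
  generalize ∑ j, e j * e j = F
  have h : p * E * p = E * p := by linear_combination E * hpp
  rw [h]
  linear_combination (4 + 2 * E * ((1 - r) ^ 2 - 2 * (1 - r))) * hpp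

end Expressions

/-! ### Uniform `O(δ)` estimates from a quotient of bounded families -/

section Asymptotics

variable {ι : Type*} (𝒜 : ι → Type*) [∀ i, CStarAlgebra (𝒜 i)] (δ : ι → ℝ)

/-- Bounded families of elements of C⋆-algebras. -/
def boundedFamilies : Subalgebra ℂ (∀ i, 𝒜 i) where
  carrier := {f | ∃ C : ℝ, ∀ i, ‖f i‖ ≤ C}
  mul_mem' := by
    rintro f g ⟨C, hC⟩ ⟨D, hD⟩
    exact ⟨C * D, fun i => (norm_mul_le _ _).trans
      (mul_le_mul (hC i) (hD i) (norm_nonneg _) ((norm_nonneg _).trans (hC i)))⟩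
  add_mem' := by
    rintro f g ⟨C, hC⟩ ⟨D, hD⟩
    exact ⟨C + D, fun i => (norm_add_le _ _).trans (add_le_add (hC i) (hD i))⟩
  algebraMap_mem' z := ⟨‖z‖, fun i => by
    rcases subsingleton_or_nontrivial (𝒜 i) with h | h
    · rw [Subsingleton.elim (algebraMap ℂ (∀ i, 𝒜 i) z i) 0]; simp
    · simp [Pi.algebraMap_apply]⟩

/-- The bounded families that are `O(δ)`. -/
def smallFamilies : Ideal (boundedFamilies 𝒜) where
  carrier := {f | ∃ C : ℝ, ∀ i, ‖f.1 i‖ ≤ C * δ i}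
  zero_mem' := ⟨0, fun i => by simp⟩
  add_mem' := by
    rintro f g ⟨C, hC⟩ ⟨D, hD⟩
    exact ⟨C + D, fun i => (norm_add_le _ _).trans (by rw [add_mul]; exact add_le_add (hC i) (hD i))⟩
  smul_mem' := by
    rintro ⟨f, C, hC⟩ g ⟨D, hD⟩
    refine ⟨C * D, fun i => (norm_mul_le _ _).trans ?_⟩
    rw [mul_assoc]
    exact mul_le_mul (hC i) (hD i) (norm_nonneg _) ((norm_nonneg _).trans (hC i))

instance : (smallFamilies 𝒜 δ).IsTwoSided where
  mul_mem_of_left := by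
    rintro f ⟨g, C, hC⟩ ⟨D, hD⟩
    refine ⟨D * C, fun i => (norm_mul_le _ _).trans ?_⟩
    calc _ ≤ (D * δ i) * C := mul_le_mul (hD i) (hC i) (norm_nonneg _) ((norm_nonneg _).trans (hD i))
      _ = _ := by ring

variable {𝒜 δ}

theorem mk_eq_mk_iff_small {f g : boundedFamilies 𝒜} :
    Ideal.Quotient.mkₐ ℂ (smallFamilies 𝒜 δ) f = Ideal.Quotient.mkₐ ℂ (smallFamilies 𝒜 δ) g ↔
      ∃ C : ℝ, ∀ i, ‖f.1 i - g.1 i‖ ≤ C * δ i := by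
  rw [Ideal.Quotient.mkₐ_eq_mk, Ideal.Quotient.mk_eq_mk_iff_sub_mem]
  rfl

/-- A fuzzy torus of width `δ` together with a selfadjoint `H` almost commuting with it, a symmetry
`S` close to `H`, and an interpolation parameter `r`. -/
structure SymmetricFuzzyTorus (k : ℕ) : Type (u + 1) where
  carrier : Type u
  [cstar : CStarAlgebra carrier]
  δ : ℝ
  r : ℝ
  T : Fin k → carrier
  H : carrier
  S : carrier
  δ_nonneg : 0 ≤ δ
  δ_le_one : δ ≤ 1
  r_nonneg : 0 ≤ r
  r_le_one : r ≤ 1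
  norm_mul_star : ∀ j, ‖T j * star (T j) - 1‖ ≤ δ
  norm_star_mul : ∀ j, ‖star (T j) * T j - 1‖ ≤ δ
  norm_commutator : ∀ j l, ‖T j * T l - T l * T j‖ ≤ δ
  norm_commutator_H : ∀ j, ‖T j * H - H * T j‖ ≤ δ
  norm_sub : ‖H - S‖ ≤ δ
  isSelfAdjoint_H : IsSelfAdjoint H
  isSelfAdjoint_S : IsSelfAdjoint S
  S_mul_S : S * S = 1

attribute [instance] SymmetricFuzzyTorus.cstar

/-- Only an inequality, because the zero algebra is allowed. -/
theorem norm_one_le (A : Type*) [CStarAlgebra A] : ‖(1 : A)‖ ≤ 1 := by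
  rcases subsingleton_or_nontrivial A with h | h
  · rw [Subsingleton.elim (1 : A) 0]; simp
  · simp

theorem norm_le_two_of_norm_mul_star {A : Type*} [CStarAlgebra A] {a : A} {δ : ℝ} (hδ : δ ≤ 1)
    (h : ‖a * star a - 1‖ ≤ δ) : ‖a‖ ≤ 2 := by
  have h1 : ‖a‖ * ‖a‖ ≤ 2 := by
    rw [← CStarRing.norm_self_mul_star]
    calc ‖a * star a‖ = ‖(a * star a - 1) + 1‖ := by rw [sub_add_cancel]
      _ ≤ ‖a * star a - 1‖ + ‖(1 : A)‖ := norm_add_le _ _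
      _ ≤ 2 := by linarith [norm_one_le A]
  nlinarith [norm_nonneg a]

theorem norm_symmetry_le {A : Type*} [CStarAlgebra A] {s : A} (hs : IsSelfAdjoint s)
    (hss : s * s = 1) : ‖s‖ ≤ 1 := by
  have h1 : ‖s‖ * ‖s‖ ≤ 1 := by
    rw [← CStarRing.norm_self_mul_star, hs.star_eq, hss]
    exact norm_one_le A
  nlinarith [norm_nonneg s]

/-- Indexing families by all tori of all widths makes equality in the quotient by `smallFamilies`
the same as an `O(δ)` bound with one constant for every torus. No explicit estimate of a
noncommutative polynomial is needed. -/
theorem exists_norm_sum_sq_sub_le (k : ℕ) :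
    ∃ C : ℝ, ∀ x : SymmetricFuzzyTorus.{u} k,
      let r := algebraMap ℂ x.carrier x.r
      let y : Fin (k + 1) → x.carrier := Fin.snoc
        (fun j => sinCoeff (x.T j) (star (x.T j)) x.S r)
        (lastCoeff x.T (fun j => star (x.T j)) x.H x.S r)
      ‖∑ j, y j * y j - (1 + excess x.T (fun j => star (x.T j)) x.S r)‖ ≤ C * x.δ ∧
      ∀ i j, ‖y i * y j - y j * y i‖ ≤ C * x.δ := by
  let 𝒜 : SymmetricFuzzyTorus.{u} k → Type u := fun x => x.carrier
  let δ : SymmetricFuzzyTorus.{u} k → ℝ := fun x => x.δ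
  let B := boundedFamilies 𝒜
  let π := Ideal.Quotient.mkₐ ℂ (smallFamilies 𝒜 δ)
  let a : Fin k → B := fun j => ⟨fun x => x.T j, 2, fun x =>
    norm_le_two_of_norm_mul_star x.δ_le_one (x.norm_mul_star j)⟩
  let b : Fin k → B := fun j => ⟨fun x => star (x.T j), 2, fun x => by
    rw [norm_star]; exact norm_le_two_of_norm_mul_star x.δ_le_one (x.norm_mul_star j)⟩
  have hS : ∀ x : SymmetricFuzzyTorus.{u} k, ‖x.S‖ ≤ 1 := fun x =>
    norm_symmetry_le x.isSelfAdjoint_S x.S_mul_S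
  let s : B := ⟨fun x => x.S, 1, hS⟩
  let h : B := ⟨fun x => x.H, 2, fun x => by
    calc ‖x.H‖ = ‖(x.H - x.S) + x.S‖ := by rw [sub_add_cancel]
      _ ≤ ‖x.H - x.S‖ + ‖x.S‖ := norm_add_le _ _
      _ ≤ 2 := by linarith [hS x, x.norm_sub, x.δ_le_one]⟩
  let r : B := ⟨fun x => algebraMap ℂ x.carrier x.r, 1, fun x => by
    change ‖algebraMap ℂ x.carrier x.r‖ ≤ 1
    rw [Algebra.algebraMap_eq_smul_one]
    refine (norm_smul_le _ _).trans ?_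
    have h1 : ‖(x.r : ℂ)‖ ≤ 1 := by
      rw [Complex.norm_real, Real.norm_of_nonneg x.r_nonneg]; exact x.r_le_one
    calc _ ≤ (1 : ℝ) * 1 := mul_le_mul h1 (norm_one_le _) (norm_nonneg _) zero_le_one
      _ = 1 := one_mul 1⟩
  -- relations in the quotient
  have hab : ∀ j, π (a j) * π (b j) = 1 := fun j => by
    rw [← map_mul, ← map_one π]
    exact mk_eq_mk_iff_small.2 ⟨1, fun x => by rw [one_mul]; exact x.norm_mul_star j⟩
  have hba : ∀ j, π (b j) * π (a j) = 1 := fun j => by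
    rw [← map_mul, ← map_one π]
    exact mk_eq_mk_iff_small.2 ⟨1, fun x => by rw [one_mul]; exact x.norm_star_mul j⟩
  have hss : π s * π s = 1 := by
    rw [← map_mul, ← map_one π]
    congr 1
    exact Subtype.ext (funext fun x => x.S_mul_S)
  have hhs : π h = π s := mk_eq_mk_iff_small.2 ⟨1, fun x => by rw [one_mul]; exact x.norm_sub⟩
  have haa : ∀ i j, Commute (π (a i)) (π (a j)) := fun i j => by
    rw [commute_iff_eq, ← map_mul, ← map_mul]
    exact mk_eq_mk_iff_small.2 ⟨1, fun x => by rw [one_mul]; exact x.norm_commutator i j⟩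
  -- Only commutators with `H` are assumed small; in the quotient `H` and `S` coincide.
  have has : ∀ i, Commute (π (a i)) (π s) := fun i => by
    rw [commute_iff_eq, ← hhs, ← map_mul, ← map_mul]
    exact mk_eq_mk_iff_small.2 ⟨1, fun x => by rw [one_mul]; exact x.norm_commutator_H i⟩
  have hr : ∀ z, Commute (π r) z := by
    intro z
    obtain ⟨z, rfl⟩ := Ideal.Quotient.mkₐ_surjective ℂ _ z
    rw [commute_iff_eq]
    change π r * π z = π z * π r
    rw [← map_mul, ← map_mul]
    congr 1
    exact Subtype.ext (funext fun x => Algebra.commutes _ _)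
  -- In the quotient `b i` is the inverse of `a i`, so it inherits every commutation relation
  -- without any use of the star.
  have hb : ∀ i z, Commute (π (a i)) z → Commute (π (b i)) z := fun i z hz =>
    Commute.units_inv_left (u := ⟨π (a i), π (b i), hab i, hba i⟩) hz
  have hcomm : ∀ z ∈ Set.range (fun j => π (a j)) ∪ Set.range (fun j => π (b j)) ∪ {π s, π r},
      ∀ w ∈ Set.range (fun j => π (a j)) ∪ Set.range (fun j => π (b j)) ∪ {π s, π r},
        z * w = w * z := by
    rintro z ((⟨i, rfl⟩ | ⟨i, rfl⟩) | rfl | rfl) w ((⟨j, rfl⟩ | ⟨j, rfl⟩) | rfl | rfl)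
    · exact haa i j
    · exact (hb j _ (haa j i)).symm
    · exact has i
    · exact (hr _).symm
    · exact hb i _ (haa i j)
    · exact hb i _ (hb j _ (haa j i)).symm
    · exact hb i _ (has i)
    · exact (hr _).symm
    · exact (has j).symm
    · exact (hb j _ (has j)).symm
    · rfl
    · exact (hr _).symm
    · exact hr _
    · exact hr _
    · exact hr _
    · rfl
  -- Generated by pairwise commuting elements, this subalgebra is a commutative ring to which the
  -- exact identity applies.
  let R := Algebra.adjoin ℂ
    (Set.range (fun j => π (a j)) ∪ Set.range (fun j => π (b j)) ∪ {π s, π r})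
  let _ : CommRing R := { (inferInstance : Ring R) with
    mul_comm := (Algebra.isMulCommutative_adjoin ℂ hcomm).is_comm.comm }
  have hsub := Algebra.subset_adjoin (R := ℂ)
    (s := Set.range (fun j => π (a j)) ∪ Set.range (fun j => π (b j)) ∪ {π s, π r})
  let a' : Fin k → R := fun j => ⟨π (a j), hsub (Or.inl (Or.inl ⟨j, rfl⟩))⟩
  let b' : Fin k → R := fun j => ⟨π (b j), hsub (Or.inl (Or.inr ⟨j, rfl⟩))⟩
  let s' : R := ⟨π s, hsub (Or.inr (Or.inl rfl))⟩
  let r' : R := ⟨π r, hsub (Or.inr (Or.inr rfl))⟩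
  let y : Fin (k + 1) → B := Fin.snoc (fun j => sinCoeff (a j) (b j) s r) (lastCoeff a b h s r)
  let y' : Fin (k + 1) → R :=
    Fin.snoc (fun j => sinCoeff (a' j) (b' j) s' r') (lastCoeff a' b' s' s' r')
  have hy : ∀ j, π (y j) = R.val (y' j) := by
    intro j
    refine Fin.lastCases ?_ (fun j => ?_) j
    · simp only [y, y', Fin.snoc_last, map_lastCoeff, hhs]; rfl
    · simp only [y, y', Fin.snoc_castSucc, map_sinCoeff]; rfl
  have key := sum_sq_eq_one_add_excess a' b' s' r' (fun j => Subtype.ext (hab j)) (Subtype.ext hss)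
  have h1 : π (∑ j, y j * y j) = π (1 + excess a b s r) := by
    simp only [map_sum, map_mul, hy, map_add, map_one, map_excess]
    have := congrArg R.val key
    simp only [map_sum, map_mul, map_add, map_one, map_excess] at this
    rw [Fin.sum_univ_castSucc]
    simp only [y', Fin.snoc_last, Fin.snoc_castSucc]
    exact this
  have h2 : ∀ i j, π (y i * y j) = π (y j * y i) := by
    intro i j
    rw [map_mul, map_mul, hy, hy, ← map_mul, mul_comm, map_mul]
  obtain ⟨C, hC⟩ := mk_eq_mk_iff_small.1 h1
  choose D hD using fun i j => mk_eq_mk_iff_small.1 (h2 i j)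
  let ev : ∀ x : SymmetricFuzzyTorus.{u} k, B →ₐ[ℂ] x.carrier := fun x =>
    (Pi.evalAlgHom ℂ 𝒜 x).comp B.val
  have hev : ∀ x j, ev x (y j) = (Fin.snoc
        (fun j => sinCoeff (x.T j) (star (x.T j)) x.S (algebraMap ℂ x.carrier x.r))
        (lastCoeff x.T (fun j => star (x.T j)) x.H x.S (algebraMap ℂ x.carrier x.r)) :
        Fin (k + 1) → x.carrier) j := by
    intro x j
    refine Fin.lastCases ?_ (fun j => ?_) j
    · simp only [y, Fin.snoc_last, map_lastCoeff]; rfl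
    · simp only [y, Fin.snoc_castSucc, map_sinCoeff]; rfl
  -- One constant dominating the one for the sum of squares and the finitely many for the
  -- commutators; the latter may be negative, hence the absolute values.
  refine ⟨max C (∑ i, ∑ j, |D i j|), fun x => ⟨?_, fun i j => ?_⟩⟩
  · have := hC x
    change ‖ev x (∑ j, y j * y j) - ev x (1 + excess a b s r)‖ ≤ _ at this
    simp only [map_sum, map_mul, hev, map_add, map_one, map_excess] at this
    exact this.trans (mul_le_mul_of_nonneg_right (le_max_left _ _) x.δ_nonneg)
  · have := hD i j x
    change ‖ev x (y i * y j) - ev x (y j * y i)‖ ≤ _ at this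
    simp only [map_mul, hev] at this
    refine this.trans (mul_le_mul_of_nonneg_right (le_trans ?_ (le_max_right _ _)) x.δ_nonneg)
    calc D i j ≤ |D i j| := le_abs_self _
      _ ≤ ∑ j, |D i j| := Finset.single_le_sum (f := fun j => |D i j|)
          (fun _ _ => abs_nonneg _) (Finset.mem_univ j)
      _ ≤ _ := Finset.single_le_sum (f := fun i => ∑ j, |D i j|)
          (fun _ _ => Finset.sum_nonneg fun _ _ => abs_nonneg _) (Finset.mem_univ i)

end Asymptotics

/-! ### Clifford combinations over a C⋆-algebra and their invertibility -/

section Tensors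

variable {E : Type*} [CStarAlgebra E] {n : ℕ}

theorem tens_apply (a : E) (γ : Matrix (Fin n) (Fin n) ℂ) (i j : Fin n) :
    tens a γ i j = γ i j • a := rfl

theorem tens_mul_tens (a b : E) (γ γ' : Matrix (Fin n) (Fin n) ℂ) :
    tens a γ * tens b γ' = tens (a * b) (γ * γ') := by
  ext i j
  simp [CStarMatrix.mul_apply, tens_apply, Matrix.mul_apply, Finset.sum_smul, smul_smul, mul_comm]

theorem star_tens (a : E) (γ : Matrix (Fin n) (Fin n) ℂ) : star (tens a γ) = tens (star a) γᴴ := by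
  ext i j
  simp [CStarMatrix.star_apply, tens_apply]

theorem tens_one_one : tens (1 : E) (1 : Matrix (Fin n) (Fin n) ℂ) = 1 := by
  ext i j
  by_cases h : i = j
  · subst h; simp [tens_apply, CStarMatrix.one_apply_eq]
  · simp [tens_apply, h]

theorem scal_eq_tens (γ : Matrix (Fin n) (Fin n) ℂ) : scal E γ = tens 1 γ := by
  ext i j
  exact Algebra.algebraMap_eq_smul_one _

theorem tens_add_left (a b : E) (γ : Matrix (Fin n) (Fin n) ℂ) :
    tens (a + b) γ = tens a γ + tens b γ := by
  ext i j; simp [tens_apply]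

theorem tens_sub_left (a b : E) (γ : Matrix (Fin n) (Fin n) ℂ) :
    tens (a - b) γ = tens a γ - tens b γ := by
  ext i j; simp [tens_apply, smul_sub]

theorem tens_smul_left (z : ℂ) (a : E) (γ : Matrix (Fin n) (Fin n) ℂ) :
    tens (z • a) γ = z • tens a γ := by
  ext i j; simp [tens_apply, smul_smul, mul_comm]

theorem tens_zero_left (γ : Matrix (Fin n) (Fin n) ℂ) : tens (0 : E) γ = 0 := by
  ext i j; simp [tens_apply]

theorem tens_neg_right (a : E) (γ : Matrix (Fin n) (Fin n) ℂ) : tens a (-γ) = -tens a γ := by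
  ext i j; simp [tens_apply]

/-- The diagonal embedding `a ↦ a ⊗ 1` as a unital ⋆-homomorphism. -/
def tensOne (E : Type*) [CStarAlgebra E] (n : ℕ) : E →⋆ₐ[ℂ] CStarMatrix (Fin n) (Fin n) E where
  toFun a := tens a 1
  map_one' := tens_one_one
  map_mul' a b := by rw [tens_mul_tens, one_mul]
  map_zero' := tens_zero_left 1
  map_add' a b := tens_add_left a b 1
  commutes' z := by
    rw [Algebra.algebraMap_eq_smul_one, tens_smul_left, tens_one_one,
      Algebra.algebraMap_eq_smul_one]
  map_star' a := by rw [star_tens, Matrix.conjTranspose_one]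

theorem tensOne_apply (a : E) : tensOne E n a = tens a 1 := rfl

/-- The combination `∑ i, y i ⊗ γ i`. -/
def cliffordSum {k : ℕ} (y : Fin k → E) (γ : Fin k → Matrix (Fin n) (Fin n) ℂ) :
    CStarMatrix (Fin n) (Fin n) E :=
  ∑ i, tens (y i) (γ i)

theorem isSelfAdjoint_cliffordSum {k : ℕ} {y : Fin k → E} {γ : Fin k → Matrix (Fin n) (Fin n) ℂ}
    (hγ : ∀ i, (γ i).IsHermitian) (hy : ∀ i, IsSelfAdjoint (y i)) :
    IsSelfAdjoint (cliffordSum y γ) := by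
  rw [isSelfAdjoint_iff, cliffordSum, star_sum]
  refine Finset.sum_congr rfl fun i _ => ?_
  rw [star_tens, (hy i).star_eq, (hγ i).eq]

theorem scal_mul_cliffordSum {k : ℕ} (y : Fin k → E) {γ : Fin k → Matrix (Fin n) (Fin n) ℂ}
    {Γ : Matrix (Fin n) (Fin n) ℂ} (hΓ : ∀ i, Γ * γ i = -(γ i * Γ)) :
    scal E Γ * cliffordSum y γ = -(cliffordSum y γ * scal E Γ) := by
  rw [scal_eq_tens, cliffordSum, Finset.mul_sum, Finset.sum_mul, ← Finset.sum_neg_distrib]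
  refine Finset.sum_congr rfl fun i _ => ?_
  rw [tens_mul_tens, tens_mul_tens, hΓ, tens_neg_right, one_mul, mul_one]

section Norms

attribute [local instance] CStarAlgebra.spectralOrder CStarAlgebra.spectralOrderedRing

/-- By the C⋆-identity the claim reduces to `a⋆a ⊗ 1`, and the ⋆-homomorphism `tensOne` is
contractive. -/
theorem norm_tens_le (a : E) {γ : Matrix (Fin n) (Fin n) ℂ} (hγ : γᴴ * γ = 1) :
    ‖tens a γ‖ ≤ ‖a‖ := by
  have h : ‖tens a γ‖ * ‖tens a γ‖ ≤ ‖a‖ * ‖a‖ := by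
    rw [← CStarRing.norm_star_mul_self, ← CStarRing.norm_star_mul_self, star_tens, tens_mul_tens,
      hγ, ← tensOne_apply]
    exact NonUnitalStarAlgHom.norm_apply_le (tensOne E n) _
  exact (mul_self_le_mul_self_iff (norm_nonneg _) (norm_nonneg _)).2 h

/-- Averaging the double sum with its transpose turns the off-diagonal part of the square into
commutators: twice the difference is `∑_{i≠j} [y_i, y_j] ⊗ γ_i γ_j`, and each `γ_i γ_j` is unitary.
-/
theorem norm_cliffordSum_mul_self_sub_le {k : ℕ} {y : Fin k → E}
    {γ : Fin k → Matrix (Fin n) (Fin n) ℂ} (hγ : IsIrreducibleClifford γ) {η : ℝ}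
    (hη : ∀ i j, ‖y i * y j - y j * y i‖ ≤ η) :
    ‖cliffordSum y γ * cliffordSum y γ - tensOne E n (∑ i, y i * y i)‖ ≤ k * k * η := by
  set c := cliffordSum y γ
  set D := tensOne E n (∑ i, y i * y i)
  have h1 : c * c = ∑ i, ∑ j, tens (y i * y j) (γ i * γ j) := by
    simp only [c, cliffordSum, Finset.sum_mul_sum, tens_mul_tens]
  have h2 : c * c = ∑ i, ∑ j, tens (y j * y i) (γ j * γ i) := by
    rw [h1, Finset.sum_comm]
  have h3 : D = ∑ i, ∑ j, if i = j then tens (y i * y j) (γ i * γ j) else 0 := by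
    simp [D, tensOne_apply, hγ.sq_eq_one]
  have h4 : (c * c - D) + (c * c - D) =
      ∑ i, ∑ j, if i = j then 0 else tens (y i * y j - y j * y i) (γ i * γ j) := by
    nth_rewrite 2 [h2]
    rw [h1, h3]
    simp only [← Finset.sum_sub_distrib, ← Finset.sum_add_distrib]
    refine Finset.sum_congr rfl fun i _ => Finset.sum_congr rfl fun j _ => ?_
    split_ifs with h
    · subst h; simp
    · rw [hγ.anticommute j i (Ne.symm h), tens_neg_right, tens_sub_left]; abel
  have hnn : ∀ i j : Fin k, 0 ≤ η := fun i j => (norm_nonneg _).trans (hη i j)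
  have h5 : ‖(c * c - D) + (c * c - D)‖ ≤ k * k * η := by
    rw [h4]
    refine (norm_sum_le_of_le _ (n := fun _ => ∑ _ : Fin k, η) fun i _ =>
      norm_sum_le_of_le _ (n := fun _ => η) fun j _ => ?_).trans (by simp [mul_assoc])
    split_ifs with h
    · rw [norm_zero]; exact hnn i j
    · refine (norm_tens_le _ ?_).trans (hη i j)
      rw [Matrix.conjTranspose_mul, hγ.isHermitian, hγ.isHermitian, Matrix.mul_assoc,
        ← Matrix.mul_assoc (γ i), hγ.sq_eq_one, Matrix.one_mul, hγ.sq_eq_one]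
  rw [← two_smul ℂ, norm_smul] at h5
  have : ‖(2 : ℂ)‖ = 2 := by norm_num
  rw [this] at h5
  linarith [norm_nonneg (c * c - D)]

/-- The order of the factors in `excess` was chosen so that each summand is a nonnegative multiple
of some `z⋆z` even when nothing commutes. -/
theorem excess_nonneg {k : ℕ} (T : Fin k → E) {S : E} (hS : IsSelfAdjoint S) {r : ℝ} (hr : 0 ≤ r) :
    0 ≤ excess T (fun j => star (T j)) S (algebraMap ℂ E r) := by
  have hq : star (negExpr S) = negExpr S := by
    simp [negExpr, hS.star_eq]
  have hw : star (weightExpr S (algebraMap ℂ E r)) = weightExpr S (algebraMap ℂ E r) := by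
    have : star (algebraMap ℂ E r) = algebraMap ℂ E r := by
      rw [← algebraMap_star_comm]; simp
    simp [weightExpr, hq, posExpr, hS.star_eq, this, (Algebra.commutes (r : ℂ) (negExpr S)).symm]
  refine add_nonneg (Finset.sum_nonneg fun j _ => ?_) ?_
  · have : algebraMap ℂ E r * (algebraMap ℂ E r + 1) = algebraMap ℝ E (r * (r + 1)) := by
      rw [IsScalarTower.algebraMap_apply ℝ ℂ E]; simp
    rw [this, ← Algebra.smul_def]
    refine smul_nonneg (by positivity) ?_
    have := star_mul_self_nonneg ((1 - T j) * negExpr S)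
    simpa [hq] using this
  · have : (1 / 4 : ℂ) = ((1 / 4 : ℝ) : ℂ) := by norm_num
    rw [this, Complex.coe_smul]
    refine smul_nonneg (by norm_num) (Finset.sum_nonneg fun j _ => Finset.sum_nonneg fun l _ => ?_)
    have := star_mul_self_nonneg ((1 - T l) * (1 - T j) * weightExpr S (algebraMap ℂ E r))
    simpa [hw, mul_assoc] using this

/-- Here `c² = 1 + p + e ≥ 1 - 3/4 = 1/4`, so by spectral mapping `0` is not in the spectrum of `c`.
-/
theorem isUnit_of_norm_mul_self_sub_le {c e p : E} (hc : IsSelfAdjoint c) (hp : 0 ≤ p)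
    (he : c * c - (1 + p) = e) (hn : ‖e‖ ≤ 3 / 4) : IsUnit c := by
  rw [← spectrum.zero_notMem_iff ℝ]
  intro ht
  have hcc : IsSelfAdjoint (c * c) := by rw [isSelfAdjoint_iff, star_mul, hc.star_eq]
  have hsa : IsSelfAdjoint e := by
    rw [← he]
    exact hcc.sub ((IsSelfAdjoint.one E).add hp.isSelfAdjoint)
  have h1 : algebraMap ℝ E (1 / 4) ≤ c * c := by
    have h2 := hsa.neg_algebraMap_norm_le_self
    have h3 : algebraMap ℝ E ‖e‖ ≤ algebraMap ℝ E (3 / 4) := algebraMap_mono E hn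
    have h4 : c * c = e + (1 + p) := by rw [← he]; abel
    rw [h4]
    calc algebraMap ℝ E (1 / 4) = -algebraMap ℝ E (3 / 4) + (1 + 0) := by
          rw [← map_neg, ← map_one (algebraMap ℝ E), ← map_zero (algebraMap ℝ E), ← map_add,
            ← map_add]; norm_num
      _ ≤ _ := add_le_add ((neg_le_neg h3).trans h2) (by gcongr)
  have h2 := (algebraMap_le_iff_le_spectrum (a := c * c) (ha := hcc)).1 h1 (0 ^ 2)
    (by rw [← sq]; exact spectrum.pow_mem_pow c 2 ht)
  norm_num at h2

/-- The uniform invertibility of the interpolated `G`-operator. -/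
theorem exists_forall_isUnit_cliffordSum (k : ℕ) :
    ∃ δ₀ : ℝ, 0 < δ₀ ∧ ∀ x : SymmetricFuzzyTorus.{u} k, x.δ ≤ δ₀ →
      ∀ (n : ℕ) (γ : Fin (k + 1) → Matrix (Fin n) (Fin n) ℂ), IsIrreducibleClifford γ →
      ∀ c : CStarMatrix (Fin n) (Fin n) x.carrier,
      c = cliffordSum (Fin.snoc
        (fun j => sinCoeff (x.T j) (star (x.T j)) x.S (algebraMap ℂ x.carrier x.r))
        (lastCoeff x.T (fun j => star (x.T j)) x.H x.S (algebraMap ℂ x.carrier x.r))) γ →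
      IsSelfAdjoint c → IsUnit c := by
  obtain ⟨C, hC⟩ := exists_norm_sum_sq_sub_le.{u} k
  have hK : 0 < (((k + 1 : ℕ) : ℝ) * (k + 1 : ℕ) + 1) * (|C| + 1) := by positivity
  -- The commutators of the `k + 1` coefficients cost `(k + 1)² C δ` and the sum of squares costs `C
  -- δ`; the total must not exceed `3/4`. The summand `1` next to `|C|` keeps the denominator
  -- positive.
  refine ⟨3 / 4 / ((((k + 1 : ℕ) : ℝ) * (k + 1 : ℕ) + 1) * (|C| + 1)), by positivity, ?_⟩
  intro x hx n γ hγ c hc hsa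
  obtain ⟨h1, h2⟩ := hC x
  rw [le_div_iff₀ hK] at hx
  have h3 := norm_cliffordSum_mul_self_sub_le hγ h2
  rw [← hc] at h3
  refine isUnit_of_norm_mul_self_sub_le hsa
    (map_nonneg (tensOne x.carrier n) (excess_nonneg x.T x.isSelfAdjoint_S x.r_nonneg)) rfl ?_
  have h4 := (NonUnitalStarAlgHom.norm_apply_le (tensOne x.carrier n) _).trans h1
  rw [map_sub, map_add, map_one] at h4
  have h5 : C * x.δ ≤ (|C| + 1) * x.δ :=
    mul_le_mul_of_nonneg_right (by linarith [le_abs_self C]) x.δ_nonneg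
  have h6 : ((k + 1 : ℕ) : ℝ) * (k + 1 : ℕ) * (C * x.δ) ≤
      ((k + 1 : ℕ) : ℝ) * (k + 1 : ℕ) * ((|C| + 1) * x.δ) :=
    mul_le_mul_of_nonneg_left h5 (by positivity)
  refine (norm_sub_le_norm_sub_add_norm_sub _ _ _).trans ((add_le_add h3 h4).trans ?_)
  calc _ ≤ ((k + 1 : ℕ) : ℝ) * (k + 1 : ℕ) * ((|C| + 1) * x.δ) + (|C| + 1) * x.δ :=
        add_le_add h6 h5
    _ = x.δ * ((((k + 1 : ℕ) : ℝ) * (k + 1 : ℕ) + 1) * (|C| + 1)) := by ring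
    _ ≤ _ := hx

end Norms

end Tensors

/-! ### The positive spectral projection -/

section SpectralProjection

variable {E : Type*} [CStarAlgebra E]

theorem continuousOn_indicator_Ioi :
    ContinuousOn (Set.indicator (Set.Ioi (0 : ℝ)) (fun _ => (1 : ℝ))) {0}ᶜ := by
  intro t ht
  refine ContinuousAt.continuousWithinAt ?_
  rcases lt_or_gt_of_ne (show t ≠ 0 from ht) with h | h
  · refine (continuousAt_const (y := (0 : ℝ))).congr ?_
    filter_upwards [Iio_mem_nhds h] with x hx
    rw [Set.indicator_of_notMem (by simpa using hx.le)]
  · refine (continuousAt_const (y := (1 : ℝ))).congr ?_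
    filter_upwards [Ioi_mem_nhds h] with x hx
    rw [Set.indicator_of_mem (by simpa using hx)]

theorem spectrum_subset_compl_zero {h : E} (hu : IsUnit h) : spectrum ℝ h ⊆ {0}ᶜ := by
  rintro t ht rfl
  exact (spectrum.zero_notMem_iff ℝ).2 hu ht

theorem isStarProjection_posProj {h : E} (hu : IsUnit h) : IsStarProjection (posProj h) := by
  have hc := continuousOn_indicator_Ioi.mono (spectrum_subset_compl_zero hu)
  refine ⟨?_, IsSelfAdjoint.cfc⟩
  rw [IsIdempotentElem, posProj, ← cfc_mul _ _ h hc hc]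
  congr 1
  ext t
  by_cases ht : t ∈ Set.Ioi (0 : ℝ) <;> simp [ht]

/-- The set `{0}ᶜ` is an open neighbourhood of all the spectra, and `χ(· > 0)` is continuous on it.
-/
theorem continuous_posProj {X : Type*} [TopologicalSpace X] {h : X → E} (hc : Continuous h)
    (hsa : ∀ x, IsSelfAdjoint (h x)) (hu : ∀ x, IsUnit (h x)) :
    Continuous fun x => posProj (h x) := by
  refine Continuous.cfc_of_mem_nhdsSet (s := {0}ᶜ) _ ?_ hc hsa continuousOn_indicator_Ioi
  exact isOpen_compl_singleton.mem_nhdsSet.2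
    (Set.iUnion_subset fun x => spectrum_subset_compl_zero (hu x))

theorem abs_sq_sub_one_le {h : E} {δ : ℝ} (hδ : ‖h * h - 1‖ ≤ δ) {t : ℝ}
    (ht : t ∈ spectrum ℝ h) : |t ^ 2 - 1| ≤ δ := by
  have h1 : t ^ 2 - 1 ∈ spectrum ℝ (h * h - 1) := by
    have := spectrum.pow_mem_pow h 2 ht
    rw [sq h] at this
    rw [← map_one (algebraMap ℝ E), ← spectrum.sub_singleton_eq]
    exact Set.sub_mem_sub this rfl
  have h2 := spectrum.norm_le_norm_mul_of_mem h1
  rw [Real.norm_eq_abs] at h2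
  calc _ ≤ ‖h * h - 1‖ * ‖(1 : E)‖ := h2
    _ ≤ ‖h * h - 1‖ * 1 := mul_le_mul_of_nonneg_left (norm_one_le E) (norm_nonneg _)
    _ ≤ δ := by rwa [mul_one]

/-- On the spectrum `|t - sgn t| ≤ |t - sgn t| |t + sgn t| = |t² - 1|`, because `|t + sgn t| ≥ 1`.
-/
theorem norm_sub_posProj_le {h : E} (hsa : IsSelfAdjoint h) (hu : IsUnit h) {δ : ℝ}
    (hδ : ‖h * h - 1‖ ≤ δ) : ‖h - (2 * posProj h - 1)‖ ≤ δ := by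
  have hc := continuousOn_indicator_Ioi.mono (spectrum_subset_compl_zero hu)
  set f := Set.indicator (Set.Ioi (0 : ℝ)) (fun _ => (1 : ℝ)) with hf
  have h1 : h - (2 * posProj h - 1) = cfc (fun t => t - (2 * f t - 1)) h := by
    rw [cfc_sub (fun t => t) (fun t => 2 * f t - 1) h continuousOn_id
      ((continuousOn_const.mul hc).sub continuousOn_const),
      cfc_sub (fun t => 2 * f t) (fun _ => 1) h (continuousOn_const.mul hc) continuousOn_const,
      cfc_const_mul 2 f h hc, cfc_id' ℝ h, cfc_const_one ℝ h, posProj, two_smul, two_mul]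
  rw [h1]
  refine norm_cfc_le ((norm_nonneg _).trans hδ) fun t ht => ?_
  have h2 := abs_sq_sub_one_le hδ ht
  rw [Real.norm_eq_abs]
  rcases lt_or_gt_of_ne (show t ≠ 0 from spectrum_subset_compl_zero hu ht) with h | h
  · have : f t = 0 := Set.indicator_of_notMem (by simpa using h.le) _
    rw [this]
    rw [show t ^ 2 - 1 = (t + 1) * (t - 1) by ring, abs_mul] at h2
    have h3 : 1 ≤ |t - 1| := by rw [abs_of_neg (by linarith)]; linarith
    rw [show t - (2 * 0 - 1) = t + 1 by ring]
    nlinarith [abs_nonneg (t + 1)]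
  · have : f t = 1 := Set.indicator_of_mem (by simpa using h) _
    rw [this]
    rw [show t ^ 2 - 1 = (t + 1) * (t - 1) by ring, abs_mul] at h2
    have h3 : 1 ≤ |t + 1| := by rw [abs_of_pos (by linarith)]; linarith
    rw [show t - (2 * 1 - 1) = t - 1 by ring]
    nlinarith [abs_nonneg (t - 1)]

end SpectralProjection

/-! ### Inverses in a corner -/

section Corner

variable {E : Type*} [CStarAlgebra E]

theorem norm_corner_le {p : E} (hp : IsStarProjection p) (a : E) : ‖p * a * p‖ ≤ ‖a‖ := by
  have h := hp.norm_le
  calc ‖p * a * p‖ ≤ ‖p‖ * ‖a‖ * ‖p‖ :=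
        (norm_mul_le _ _).trans (mul_le_mul_of_nonneg_right (norm_mul_le _ _) (norm_nonneg _))
    _ ≤ 1 * ‖a‖ * 1 := by gcongr
    _ = ‖a‖ := by ring

/-- An element of a corner that is almost unitary there is invertible there. -/
theorem exists_inverse_in_corner {p x : E} (hp : IsStarProjection p) (hx : p * x * p = x)
    (h1 : ‖x * star x - p‖ < 1) (h2 : ‖star x * x - p‖ < 1) :
    ∃ y : E, p * y * p = y ∧ x * y = p ∧ y * x = p := by
  have hpp : p * p = p := hp.isIdempotentElem
  have hps : star p = p := hp.isSelfAdjoint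
  have hpx : p * x = x := by rw [← hx, ← mul_assoc, ← mul_assoc, hpp]
  have hxp : x * p = x := by rw [← hx, mul_assoc, hpp]
  have hsp : star x * p = star x := by
    have := congrArg star hpx; rwa [star_mul, hps] at this
  have hps' : p * star x = star x := by
    have := congrArg star hxp; rwa [star_mul, hps] at this
  -- Completed by `1 - p`, such a `z` lies within distance less than `1` of the unit of `E`. It is
  -- invertible there, and the inverse commutes with `p`.
  have key : ∀ z : E, p * z = z → z * p = z → ‖z - p‖ < 1 →
      ∃ w : E, p * w = w ∧ w * p = w ∧ z * w = p ∧ w * z = p := by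
    intro z hz hz' hn
    have hu : IsUnit (z + (1 - p)) := by
      have := (Units.oneSub (-(z - p)) (by rwa [norm_neg])).isUnit
      simp only [Units.val_oneSub] at this
      convert this using 1; abel
    obtain ⟨u, hu⟩ := hu
    have hc : (u : E) * p = p * u := by
      rw [hu, add_mul, mul_add, hz, hz', sub_mul, mul_sub, hpp, one_mul, mul_one]
    have hc' : (↑u⁻¹ : E) * p = p * ↑u⁻¹ := (Commute.units_inv_left (u := u) hc).eq
    have hzp : z = u * p := by
      rw [hu, add_mul, hz', sub_mul, hpp, one_mul, sub_self, add_zero]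
    refine ⟨↑u⁻¹ * p, ?_, ?_, ?_, ?_⟩
    · rw [hc', ← mul_assoc, hpp]
    · rw [mul_assoc, hpp]
    · rw [hzp, mul_assoc, ← mul_assoc p, ← hc', mul_assoc, hpp, Units.mul_inv_cancel_left]
    · rw [hzp, hc, ← mul_assoc, mul_assoc _ p p, hpp, mul_assoc, ← hc, ← mul_assoc]; simp
  obtain ⟨w, hw1, hw2, hw3, -⟩ := key (x * star x) (by rw [← mul_assoc, hpx])
    (by rw [mul_assoc, hsp]) h1
  obtain ⟨v, hv1, hv2, -, hv4⟩ := key (star x * x) (by rw [← mul_assoc, hps'])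
    (by rw [mul_assoc, hxp]) h2
  -- The left inverse `v x⋆` and the right inverse `x⋆ w` of `x` agree, as in any monoid.
  have hl : v * star x = star x * w := by
    calc v * star x = v * star x * p := by rw [mul_assoc, hsp]
      _ = (v * (star x * x)) * (star x * w) := by rw [← hw3]; simp only [mul_assoc]
      _ = star x * w := by rw [hv4, ← mul_assoc, hps']
  refine ⟨star x * w, ?_, ?_, ?_⟩
  · rw [← mul_assoc, hps', mul_assoc, hw2]
  · rw [← mul_assoc, hw3]
  · rw [← hl, mul_assoc, hv4]

end Corner

/-! ### The restricted torus of a graded torus -/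

section GradedTorus

variable {E : Type*} [CStarAlgebra E] {d : ℕ} {δ : ℝ} {T : Fin (d + 1) → E}

theorem IsFuzzyTorusIn.isUnit {d : ℕ} {T : Fin d → E} (h : IsFuzzyTorusIn 1 δ T) (j : Fin d) :
    IsUnit (T j) := by
  obtain ⟨R, -, h1, h2⟩ := h.invertible j
  exact ⟨⟨T j, R, h1, h2⟩, rfl⟩

theorem IsGradedFuzzyTorus.isStarProjection (h : IsGradedFuzzyTorus δ T) :
    IsStarProjection (gradingProj T) :=
  isStarProjection_posProj (h.2.isUnit _)

/-- The symmetry `2P - 1` of a graded torus. -/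
def gradingSymm (T : Fin (d + 1) → E) : E := 2 * gradingProj T - 1

theorem IsGradedFuzzyTorus.isSelfAdjoint_symm (h : IsGradedFuzzyTorus δ T) :
    IsSelfAdjoint (gradingSymm T) := by
  have := h.isStarProjection.isSelfAdjoint.star_eq
  simp [isSelfAdjoint_iff, gradingSymm, this, two_mul]

theorem IsGradedFuzzyTorus.symm_mul_symm (h : IsGradedFuzzyTorus δ T) :
    gradingSymm T * gradingSymm T = 1 := by
  have : gradingProj T * gradingProj T = gradingProj T := h.isStarProjection.isIdempotentElem
  simp only [gradingSymm, two_mul, mul_sub, sub_mul, mul_add, add_mul, this, mul_one, one_mul]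
  abel

theorem posExpr_gradingSymm (T : Fin (d + 1) → E) : posExpr (gradingSymm T) = gradingProj T := by
  rw [posExpr, gradingSymm, add_sub_cancel, two_mul, ← two_smul ℂ, smul_smul]
  norm_num

theorem IsGradedFuzzyTorus.norm_sub_symm_le (h : IsGradedFuzzyTorus δ T) :
    ‖T (Fin.last d) - gradingSymm T‖ ≤ δ := by
  refine norm_sub_posProj_le h.1 (h.2.isUnit _) ?_
  have := h.2.norm_mul_star (Fin.last d)
  rwa [h.1.star_eq] at this

/-- With `H = T (Fin.last d)` and `S = 2P - 1`, twice the commutator is `[T_j, S] = [T_j, H] - [T_j,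
H - S]`, bounded by `δ + 2 · 2δ` since `‖T_j‖ ≤ 2`. -/
theorem IsGradedFuzzyTorus.norm_commutator_proj_le (h : IsGradedFuzzyTorus δ T)
    (j : Fin (d + 1)) :
    ‖T j * gradingProj T - gradingProj T * T j‖ ≤ 5 / 2 * δ := by
  have h1 : (2 : ℂ) • (T j * gradingProj T - gradingProj T * T j) =
      (T j * T (Fin.last d) - T (Fin.last d) * T j) -
        (T j * (T (Fin.last d) - gradingSymm T) - (T (Fin.last d) - gradingSymm T) * T j) := by
    rw [gradingSymm, two_smul]; noncomm_ring
  have h2 := h.2.norm_commutator j (Fin.last d)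
  have h3 := norm_le_two_of_norm_mul_star h.2.width_lt_one.le (h.2.norm_mul_star j)
  have h4 := h.norm_sub_symm_le
  have h5 : ‖(2 : ℂ) • (T j * gradingProj T - gradingProj T * T j)‖ ≤
      δ + (2 * δ + δ * 2) := by
    rw [h1]
    refine (norm_sub_le _ _).trans (add_le_add h2 ((norm_sub_le _ _).trans (add_le_add ?_ ?_)))
    · exact (norm_mul_le _ _).trans (mul_le_mul h3 h4 (norm_nonneg _) (by norm_num))
    · exact (norm_mul_le _ _).trans (mul_le_mul h4 h3 (norm_nonneg _) h.2.width_nonneg)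
  rw [norm_smul] at h5
  norm_num at h5
  linarith

/-- Compression by `P` is multiplicative up to `P [P, a] [b, P] P`, which is of second order in `δ`.
The proof yields `2δ` for almost unitarity and `3δ` for commutators, within the stated `6δ`. -/
theorem IsGradedFuzzyTorus.isFuzzyTorusIn_restricted (h : IsGradedFuzzyTorus δ T)
    (hδ : δ ≤ 1 / 13) : IsFuzzyTorusIn (gradingProj T) (6 * δ) (restrictedTorus T) := by
  have hP := h.isStarProjection
  have hC := h.norm_commutator_proj_le
  have hδ0 := h.2.width_nonneg
  have hT := h.2
  unfold restrictedTorus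
  set P := gradingProj T
  have hPP : P * P = P := hP.isIdempotentElem
  have hPs : star P = P := hP.isSelfAdjoint
  have hC' : ∀ j, ‖star (T j) * P - P * star (T j)‖ ≤ 5 / 2 * δ := fun j => by
    rw [← norm_neg, ← norm_star]
    simpa [hPs] using hC j
  -- commuting `P` past both factors costs a product of two commutators
  have key : ∀ a b : E, ‖a * P - P * a‖ ≤ 5 / 2 * δ → ‖b * P - P * b‖ ≤ 5 / 2 * δ →
      ∃ z, P * a * P * (P * b * P) = P * (a * b) * P - z ∧ ‖z‖ ≤ 5 / 2 * δ * (5 / 2 * δ) := by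
    intro a b ha hb
    refine ⟨P * ((P * a - a * P) * (b * P - P * b)) * P, ?_, ?_⟩
    · have h1 : P * a * P * (P * b * P) = P * a * P * b * P := by
        simp only [← mul_assoc]; rw [mul_assoc (P * a) P P, hPP]
      have h2 : P * ((P * a - a * P) * (b * P - P * b)) * P =
        (P * P) * a * b * (P * P) - (P * P) * a * P * b * P - P * a * P * b * (P * P)
          + P * a * (P * P) * b * P := by noncomm_ring
      rw [h1, h2]; simp only [hPP]; noncomm_ring
    · refine (norm_corner_le hP _).trans ((norm_mul_le _ _).trans ?_)
      rw [norm_sub_rev (P * a)]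
      exact mul_le_mul ha hb (norm_nonneg _) (by linarith)
  -- The second-order error is absorbed into `δ`; `δ ≤ 4/25` would suffice here.
  have hsq : 5 / 2 * δ * (5 / 2 * δ) ≤ δ := by nlinarith
  have near : ∀ a b : E, ‖a * P - P * a‖ ≤ 5 / 2 * δ → ‖b * P - P * b‖ ≤ 5 / 2 * δ →
      ‖a * b - 1‖ ≤ δ → ‖P * a * P * (P * b * P) - P‖ ≤ 2 * δ := by
    intro a b ha hb hab
    obtain ⟨z, hz, hz'⟩ := key a b ha hb
    have h1 : P * a * P * (P * b * P) - P = P * (a * b - 1) * P - z := by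
      rw [hz, mul_sub, sub_mul, mul_one, hPP]; abel
    rw [h1]
    refine (norm_sub_le _ _).trans ?_
    linarith [norm_corner_le hP (a * b - 1)]
  have hstar : ∀ j : Fin (d + 1), star (P * T j * P) = P * star (T j) * P := fun j => by
    rw [star_mul, star_mul, hPs, mul_assoc]
  have hcor : ∀ a : E, P * (P * a * P) * P = P * a * P := fun a => by
    simp only [← mul_assoc]; rw [hPP, mul_assoc _ P P, hPP]
  have n1 : ∀ j : Fin d, ‖P * T j.castSucc * P * star (P * T j.castSucc * P) - P‖ ≤ 2 * δ :=
    fun j => by rw [hstar]; exact near _ _ (hC _) (hC' _) (hT.norm_mul_star _)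
  have n2 : ∀ j : Fin d, ‖star (P * T j.castSucc * P) * (P * T j.castSucc * P) - P‖ ≤ 2 * δ :=
    fun j => by rw [hstar]; exact near _ _ (hC' _) (hC _) (hT.norm_star_mul _)
  refine ⟨by linarith, by linarith, fun j => hcor _, fun j => ?_, fun j => ?_, fun j => ?_,
    fun j i => ?_⟩
  · exact exists_inverse_in_corner hP (hcor _) ((n1 j).trans_lt (by linarith))
      ((n2 j).trans_lt (by linarith))
  · exact (n1 j).trans (by linarith)
  · exact (n2 j).trans (by linarith)
  · obtain ⟨z, hz, hz'⟩ := key (T j.castSucc) (T i.castSucc) (hC _) (hC _)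
    obtain ⟨w, hw, hw'⟩ := key (T i.castSucc) (T j.castSucc) (hC _) (hC _)
    have h1 : P * T j.castSucc * P * (P * T i.castSucc * P) -
        P * T i.castSucc * P * (P * T j.castSucc * P) =
        P * (T j.castSucc * T i.castSucc - T i.castSucc * T j.castSucc) * P - (z - w) := by
      rw [hz, hw]; noncomm_ring
    rw [h1]
    have h2 := norm_corner_le hP (T j.castSucc * T i.castSucc - T i.castSucc * T j.castSucc)
    have h3 := hT.norm_commutator j.castSucc i.castSucc
    linarith [norm_sub_le (P * (T j.castSucc * T i.castSucc - T i.castSucc * T j.castSucc) * P)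
      (z - w), norm_sub_le z w]

end GradedTorus

/-! ### The volume element and further Clifford generators -/

section Clifford

variable {n : ℕ}

/-- The product of the generators of a Clifford algebra. -/
theorem exists_volume_element {k : ℕ} (γ : Fin k → Matrix (Fin n) (Fin n) ℂ)
    (hh : ∀ i, (γ i).IsHermitian) (hs : ∀ i, γ i * γ i = 1)
    (ha : ∀ i j, i ≠ j → γ i * γ j = -(γ j * γ i)) :
    ∃ ω : Matrix (Fin n) (Fin n) ℂ, (ωᴴ = ω ∨ ωᴴ = -ω) ∧ ω * ωᴴ = 1 ∧
      (∀ M, (∀ i, γ i * M = -(M * γ i)) → ω * M = (-1 : ℂ) ^ k • (M * ω)) ∧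
      ∀ i, ω * γ i = (-1 : ℂ) ^ (k + 1) • (γ i * ω) := by
  induction k with
  | zero => exact ⟨1, by simp, by simp, by simp, fun i => i.elim0⟩
  | succ k ih =>
    obtain ⟨ω, h1, h2, h3, h4⟩ := ih (fun i => γ i.castSucc) (fun i => hh _) (fun i => hs _)
      (fun i j hij => ha _ _ (by simpa using hij))
    -- The clause about a general `M` feeds the induction: here `M` is the new generator.
    have hg := h3 (γ (Fin.last k)) (fun i => ha _ _ (Fin.castSucc_lt_last i).ne)
    have hgg := hs (Fin.last k)
    have hgh := (hh (Fin.last k)).eq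
    have hag : ∀ i : Fin k, γ (Fin.last k) * γ i.castSucc =
        -(γ i.castSucc * γ (Fin.last k)) := fun i => ha _ _ (Fin.castSucc_lt_last i).ne'
    have hgl : ∀ M, γ (Fin.last k) * M = -(M * γ (Fin.last k)) →
      (∀ i : Fin k, γ i.castSucc * M = -(M * γ i.castSucc)) →
      ω * γ (Fin.last k) * M = (-1 : ℂ) ^ (k + 1) • (M * (ω * γ (Fin.last k))) := by
      intro M hM hM'
      rw [mul_assoc, hM, mul_neg, ← mul_assoc, h3 M hM', pow_succ]
      simp [mul_assoc]
    refine ⟨ω * γ (Fin.last k), ?_, ?_, fun M hM => hgl M (hM _) (fun i => hM _), fun i => ?_⟩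
    · have h5 : (ω * γ (Fin.last k))ᴴ = ω * γ (Fin.last k) ∨
          (ω * γ (Fin.last k))ᴴ = -(ω * γ (Fin.last k)) := by
        rw [Matrix.conjTranspose_mul, hgh, hg]
        rcases neg_one_pow_eq_or ℂ k with hk | hk <;> rcases h1 with h1 | h1 <;> simp [hk, h1]
      exact h5
    · rw [Matrix.conjTranspose_mul, hgh, mul_assoc, ← mul_assoc (γ _), hgg, one_mul, h2]
    · refine Fin.lastCases ?_ (fun i => ?_) i
      · nth_rewrite 2 [hg]
        rw [mul_assoc, hgg, mul_smul_comm, ← mul_assoc, hgg, smul_smul, ← pow_add, mul_one, one_mul,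
          show k + 1 + 1 + k = 2 * (k + 1) by ring, pow_mul]
        simp
      · rw [mul_assoc, hag, mul_neg, ← mul_assoc, h4, pow_succ (-1 : ℂ) (k + 1)]
        simp [mul_assoc]

/-- For an even number of generators their product anticommutes with each of them; if it is
skew-adjoint, a factor `i` makes it selfadjoint. -/
theorem IsIrreducibleClifford.exists_further {k : ℕ} {γ : Fin k → Matrix (Fin n) (Fin n) ℂ}
    (hγ : IsIrreducibleClifford γ) (hk : Even k) : ∃ Γ, IsFurtherGenerator γ Γ := by
  obtain ⟨ω, h1, h2, -, h3⟩ := exists_volume_element γ hγ.isHermitian hγ.sq_eq_one hγ.anticommute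
  simp only [hk.add_one.neg_one_pow, neg_smul, one_smul] at h3
  rcases h1 with h1 | h1
  · exact ⟨ω, h1, by rw [h1] at h2; exact h2, h3⟩
  · refine ⟨Complex.I • ω, ?_, ?_, fun i => ?_⟩
    · rw [Matrix.IsHermitian, Matrix.conjTranspose_smul, h1]; simp
    · rw [h1, mul_neg] at h2
      rw [smul_mul_smul_comm, Complex.I_mul_I, neg_smul, one_smul, h2]
    · rw [smul_mul_assoc, h3, mul_smul_comm, smul_neg]

end Clifford

/-! ### Eigenbases of symmetries and connectedness of the complex general linear group -/

section Eigenbasis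

variable {n : ℕ}

/-- A complex projection matrix is `S Sᴴ` for an isometry `S`. -/
theorem exists_isometry_of_projection {p : Matrix (Fin n) (Fin n) ℂ} (hp : p.IsHermitian)
    (hpp : p * p = p) :
    ∃ (m : ℕ) (S : Matrix (Fin n) (Fin m) ℂ), Sᴴ * S = 1 ∧ S * Sᴴ = p := by
  classical
  set U : Matrix (Fin n) (Fin n) ℂ := hp.eigenvectorUnitary.1
  have hU : Uᴴ * U = 1 := Unitary.star_mul_self_of_mem hp.eigenvectorUnitary.2
  have hsp : p = U * Matrix.diagonal (fun i => (hp.eigenvalues i : ℂ)) * Uᴴ := hp.spectral_theorem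
  have hD : Matrix.diagonal (fun i => (hp.eigenvalues i : ℂ)) = Uᴴ * p * U := by
    conv_rhs => rw [hsp]
    rw [← mul_assoc, ← mul_assoc, hU, one_mul, mul_assoc, hU, mul_one]
  have hUU : U * Uᴴ = 1 := Unitary.mul_star_self_of_mem hp.eigenvectorUnitary.2
  have hDD : Matrix.diagonal (fun i => (hp.eigenvalues i : ℂ)) *
      Matrix.diagonal (fun i => (hp.eigenvalues i : ℂ)) =
      Matrix.diagonal (fun i => (hp.eigenvalues i : ℂ)) := by
    rw [hD]
    calc Uᴴ * p * U * (Uᴴ * p * U) = Uᴴ * (p * (U * Uᴴ) * p) * U := by simp only [mul_assoc]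
      _ = _ := by rw [hUU, mul_one, hpp]
  -- Idempotence forces eigenvalues `0` or `1`; the columns of `S` are the eigenvectors for `1`.
  have hev : ∀ i, (hp.eigenvalues i : ℂ) = if hp.eigenvalues i = 1 then 1 else 0 := by
    intro i
    have h := congrFun (congrFun hDD i) i
    rw [Matrix.diagonal_mul_diagonal, Matrix.diagonal_apply_eq, Matrix.diagonal_apply_eq] at h
    norm_cast at h
    split_ifs with h1
    · rw [h1]; norm_num
    · have : hp.eigenvalues i * (hp.eigenvalues i - 1) = 0 := by linear_combination h
      rcases mul_eq_zero.1 this with h2 | h2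
      · rw [h2]; norm_num
      · exact absurd (by linarith) h1
  let e := (Fintype.equivFin {i // hp.eigenvalues i = 1}).symm
  refine ⟨_, U.submatrix id (fun j => (e j : Fin n)), ?_, ?_⟩
  · have : (U.submatrix id (fun j => (e j : Fin n)))ᴴ * U.submatrix id (fun j => (e j : Fin n)) =
        (Uᴴ * U).submatrix (fun j => (e j : Fin n)) (fun j => (e j : Fin n)) := rfl
    rw [this, hU]
    exact Matrix.submatrix_one _ (Subtype.val_injective.comp e.injective)
  · ext i j
    conv_rhs => rw [hsp]
    rw [Matrix.mul_apply, Matrix.mul_apply]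
    simp only [Matrix.mul_diagonal, hev, Matrix.submatrix_apply, Matrix.conjTranspose_apply, id]
    rw [e.sum_comp (fun x : {i // hp.eigenvalues i = 1} => U i x * star (U j x))]
    simp only [mul_ite, mul_one, mul_zero, ite_mul, zero_mul]
    rw [← Finset.sum_filter]
    exact (Finset.sum_subtype _ (by simp) (fun x => U i x * star (U j x))).symm

/-- A symmetry that anticommutes with another one has an orthonormal eigenbasis with eigenspaces
of equal dimension. -/
theorem exists_eigenbasis {Γ g : Matrix (Fin n) (Fin n) ℂ} (hΓ : Γ.IsHermitian) (hΓΓ : Γ * Γ = 1)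
    (hg : g.IsHermitian) (hgg : g * g = 1) (ha : Γ * g = -(g * Γ)) :
    ∃ (m : ℕ) (S T : Matrix (Fin n) (Fin m) ℂ),
      Sᴴ * S = 1 ∧ Tᴴ * T = 1 ∧ S * Sᴴ + T * Tᴴ = 1 ∧ S * Sᴴ - T * Tᴴ = Γ := by
  obtain ⟨m, S, h1, h2⟩ := exists_isometry_of_projection (p := (1 / 2 : ℂ) • (1 + Γ))
    (by rw [Matrix.IsHermitian, Matrix.conjTranspose_smul, Matrix.conjTranspose_add, hΓ.eq]; simp)
    (by
      rw [smul_mul_smul_comm, add_mul, mul_add, mul_add, hΓΓ, one_mul, mul_one, one_mul,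
        add_comm Γ 1, ← two_smul ℂ (1 + Γ), smul_smul]
      norm_num)
  -- The anticommuting symmetry `g` maps the `+1` eigenspace of `Γ` onto the `-1` eigenspace, so `T
  -- = g S` serves, with the same number of columns.
  have h3 : g * S * (g * S)ᴴ = (1 / 2 : ℂ) • (1 - Γ) := by
    rw [Matrix.conjTranspose_mul, hg.eq, Matrix.mul_assoc, ← Matrix.mul_assoc S, h2,
      smul_mul_assoc, mul_smul_comm, add_mul, ha, one_mul, mul_add, mul_neg, ← mul_assoc, hgg,
      one_mul, sub_eq_add_neg]
  refine ⟨m, S, g * S, h1, ?_, ?_, ?_⟩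
  · rw [Matrix.conjTranspose_mul, hg.eq, Matrix.mul_assoc, ← Matrix.mul_assoc g, hgg,
      Matrix.one_mul, h1]
  · rw [h2, h3, ← smul_add]
    rw [show (1 + Γ + (1 - Γ)) = (2 : ℂ) • 1 by rw [two_smul]; abel, smul_smul]; norm_num
  · rw [h2, h3, ← smul_sub]
    rw [show (1 + Γ - (1 - Γ)) = (2 : ℂ) • Γ by rw [two_smul]; abel, smul_smul]; norm_num

/-- Complex invertible matrices are connected to the identity. -/
theorem joinedIn_isUnit_one {m : ℕ} {U : Matrix (Fin m) (Fin m) ℂ} (hU : IsUnit U) :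
    JoinedIn {M : Matrix (Fin m) (Fin m) ℂ | IsUnit M} 1 U := by
  let L : ℂ → Matrix (Fin m) (Fin m) ℂ := fun z => (1 - z) • 1 + z • U
  -- The determinant along the complex line from `1` to `U`: a nonzero polynomial, so the line meets
  -- the singular matrices in finitely many points, which a path in `ℂ` can avoid.
  let q : Polynomial ℂ := ((1 - Polynomial.X : Polynomial ℂ) • (1 : Matrix (Fin m) (Fin m) (Polynomial ℂ)) +
    (Polynomial.X : Polynomial ℂ) • U.map Polynomial.C).det
  have hq : ∀ z, q.eval z = (L z).det := by
    intro z
    simp only [q, ← Polynomial.coe_evalRingHom, RingHom.map_det]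
    congr 1
    ext i j
    by_cases h : i = j
    · subst h; simp [L, mul_comm z]
    · simp [L, h, mul_comm z]
  have hq0 : q ≠ 0 := by
    intro h
    have := hq 0
    simp [h, L] at this
  have hunit : ∀ z, IsUnit (L z) ↔ z ∈ (q.rootSet ℂ)ᶜ := by
    intro z
    rw [Matrix.isUnit_iff_isUnit_det, isUnit_iff_ne_zero, ← hq]
    simp [Polynomial.mem_rootSet, hq0, Polynomial.coe_aeval_eq_eval]
  have hpc := (q.rootSet_finite ℂ).countable.isPathConnected_compl_of_one_lt_rank
    (by rw [Complex.rank_real_complex]; exact Cardinal.one_lt_two)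
  have hj := hpc.joinedIn 0 ((hunit 0).1 (by simp [L])) 1 ((hunit 1).1 (by simpa [L] using hU))
  obtain ⟨p, hp⟩ := hj
  have hL : Continuous L := by fun_prop
  refine ⟨(p.map hL).cast (by simp [L]) (by simp [L]), fun t => (hunit _).2 (hp t)⟩

end Eigenbasis

/-! ### The interpolated operator and its uniform invertibility -/

section Interpolation

variable {E : Type*} [CStarAlgebra E] {d n : ℕ}

/-- The segment between `Ĝ_I` (at `r = 1`) and the completed restricted operator (at `r = 0`). -/
def interpOp (T : Fin (d + 1) → E) (I : Finset (Fin d))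
    (γ : Fin (I.card + 1) → Matrix (Fin n) (Fin n) ℂ) (r : ℝ) : CStarMatrix (Fin n) (Fin n) E :=
  (r : ℂ) • gHatOp T I γ + (1 - r : ℂ) • gRestrictedOp T I γ

/-- The subfamily of a graded torus with indices in `I`. -/
def subTorus (T : Fin (d + 1) → E) (I : Finset (Fin d)) : Fin I.card → E :=
  fun j => T (I.orderEmbOfFin rfl j).castSucc

theorem imExpr_star (a : E) : imExpr a (star a) = (imaginaryPart a : E) := by
  rw [imaginaryPart_apply_coe, imExpr, ← Complex.coe_smul, smul_smul]
  congr 1; push_cast; ring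

theorem oneSubReExpr_star (a : E) : oneSubReExpr a (star a) = 1 - (realPart a : E) := by
  rw [realPart_apply_coe, oneSubReExpr, ← Complex.coe_smul]
  norm_num

theorem cliffordSum_snoc {k : ℕ} (y : Fin k → E) (z : E)
    (γ : Fin (k + 1) → Matrix (Fin n) (Fin n) ℂ) :
    cliffordSum (Fin.snoc y z) γ =
      ∑ j, tens (y j) (γ j.castSucc) + tens z (γ (Fin.last k)) := by
  rw [cliffordSum, Fin.sum_univ_castSucc]
  simp

/-- At `r = 0` the completion is already contained in `-S = -P + (1 - P)`, and `P (1 - Re a) P = P -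
Re (P a P)`; this matches `gRestrictedOp` with the abstract coefficients. -/
theorem interpOp_eq_cliffordSum {T : Fin (d + 1) → E}
    (hP : IsStarProjection (gradingProj T)) (I : Finset (Fin d))
    (γ : Fin (I.card + 1) → Matrix (Fin n) (Fin n) ℂ) (r : ℝ) :
    interpOp T I γ r = cliffordSum (Fin.snoc
      (fun j => sinCoeff (subTorus T I j) (star (subTorus T I j)) (gradingSymm T)
        (algebraMap ℂ E r))
      (lastCoeff (subTorus T I) (fun j => star (subTorus T I j)) (T (Fin.last d)) (gradingSymm T)
        (algebraMap ℂ E r))) γ := by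
  have hPP : gradingProj T * gradingProj T = gradingProj T := hP.isIdempotentElem
  have hPs : star (gradingProj T) = gradingProj T := hP.isSelfAdjoint
  have hstar : ∀ a, star (gradingProj T * a * gradingProj T) =
      gradingProj T * star a * gradingProj T := fun a => by
    rw [star_mul, star_mul, hPs, mul_assoc]
  have him : ∀ a, (imaginaryPart (gradingProj T * a * gradingProj T) : E) =
      gradingProj T * imExpr a (star a) * gradingProj T := fun a => by
    rw [← imExpr_star, hstar, imExpr, imExpr, mul_smul_comm, smul_mul_assoc, mul_sub, sub_mul]
  have hre : ∀ a, (realPart (gradingProj T * a * gradingProj T) : E) =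
      gradingProj T - gradingProj T * oneSubReExpr a (star a) * gradingProj T := fun a => by
    have h := oneSubReExpr_star (gradingProj T * a * gradingProj T)
    rw [eq_sub_iff_add_eq, ← eq_sub_iff_add_eq'] at h
    rw [h, hstar, oneSubReExpr, oneSubReExpr, mul_sub, sub_mul, mul_one, hPP, mul_smul_comm,
      smul_mul_assoc, mul_add, add_mul]
    abel
  have hsum : ∑ j, (realPart (subTorus T I j) : E) =
      (I.card : ℂ) • (1 : E) - ∑ j, oneSubReExpr (subTorus T I j) (star (subTorus T I j)) := by
    simp only [oneSubReExpr_star, Finset.sum_sub_distrib]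
    simp [Nat.cast_smul_eq_nsmul]
  have hsc : ∀ x : E, algebraMap ℂ E r * x = (r : ℂ) • x := fun x => (Algebra.smul_def _ _).symm
  have hsc' : ∀ x : E, (1 - algebraMap ℂ E r) * x = (1 - r : ℂ) • x := fun x => by
    rw [sub_mul, hsc, one_mul, sub_smul, one_smul]
  rw [cliffordSum_snoc, interpOp, gHatOp, gRestrictedOp, gOp]
  simp only [restrictedTorus, him, hre]
  rw [add_assoc (∑ j, _) (tens _ _) (tens _ _), ← tens_add_left, smul_add, smul_add, add_add_add_comm,
    ← tens_smul_left, ← tens_smul_left, ← tens_add_left, Finset.smul_sum, Finset.smul_sum,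
    ← Finset.sum_add_distrib]
  congr 1
  · refine Finset.sum_congr rfl fun j _ => ?_
    rw [← tens_smul_left, ← tens_smul_left, ← tens_add_left, sinCoeff, hsc, hsc',
      posExpr_gradingSymm]
    simp only [imExpr_star]
    rfl
  · congr 1
    rw [lastCoeff, hsc, hsc', hsc, hsc', posExpr_gradingSymm]
    change (r : ℂ) • ((I.card : ℂ) • (1 : E) - ∑ j, (realPart (subTorus T I j) : E) -
      T (Fin.last d)) + (1 - r : ℂ) • (((I.card : ℂ) - 1) • gradingProj T -
        ∑ j, (gradingProj T - gradingProj T *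
          oneSubReExpr (subTorus T I j) (star (subTorus T I j)) * gradingProj T) +
        (1 - gradingProj T)) = _
    rw [hsum, Finset.sum_sub_distrib, ← Finset.sum_mul, ← Finset.mul_sum, gradingSymm]
    simp only [Finset.sum_const, Finset.card_univ, Fintype.card_fin, ← Nat.cast_smul_eq_nsmul ℂ,
      two_mul]
    module

theorem isSelfAdjoint_interpOp {δ : ℝ} {T : Fin (d + 1) → E} (hT : IsGradedFuzzyTorus δ T)
    (I : Finset (Fin d)) {γ : Fin (I.card + 1) → Matrix (Fin n) (Fin n) ℂ}
    (hγ : IsIrreducibleClifford γ) (r : ℝ) : IsSelfAdjoint (interpOp T I γ r) := by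
  have hr : star (algebraMap ℂ E r) = algebraMap ℂ E r := by
    rw [← algebraMap_star_comm]; simp
  have hc : ∀ x : E, x * algebraMap ℂ E r = algebraMap ℂ E r * x := fun x =>
    (Algebra.commutes _ _).symm
  have hP := posExpr_gradingSymm T
  have hPs : star (gradingProj T) = gradingProj T := hT.isStarProjection.isSelfAdjoint
  have hS := hT.isSelfAdjoint_symm.star_eq
  rw [interpOp_eq_cliffordSum hT.isStarProjection]
  refine isSelfAdjoint_cliffordSum hγ.isHermitian fun i => ?_
  refine Fin.lastCases ?_ (fun j => ?_) i
  · simp only [Fin.snoc_last, isSelfAdjoint_iff, lastCoeff, hP, oneSubReExpr_star]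
    simp [hr, hPs, hS, hc, hT.1.star_eq, mul_sub, sub_mul, mul_assoc]
  · simp only [Fin.snoc_castSucc, isSelfAdjoint_iff, sinCoeff, hP, imExpr_star]
    simp [hr, hPs, hc, sub_mul, mul_assoc]

theorem interpOp_one (T : Fin (d + 1) → E) (I : Finset (Fin d))
    (γ : Fin (I.card + 1) → Matrix (Fin n) (Fin n) ℂ) : interpOp T I γ 1 = gHatOp T I γ := by
  simp [interpOp]

theorem interpOp_zero (T : Fin (d + 1) → E) (I : Finset (Fin d))
    (γ : Fin (I.card + 1) → Matrix (Fin n) (Fin n) ℂ) :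
    interpOp T I γ 0 = gRestrictedOp T I γ := by
  simp [interpOp]

/-- Reduces the ungraded case to the graded one: the grading `1` lowers the scalar `|I|` to `|I| -
1`. -/
theorem gHatOp_snoc_one (T : Fin d → E) (I : Finset (Fin d))
    (γ : Fin (I.card + 1) → Matrix (Fin n) (Fin n) ℂ) :
    gHatOp (Fin.snoc T 1 : Fin (d + 1) → E) I γ = gOp 1 T I γ := by
  simp only [gHatOp, gOp, Fin.snoc_castSucc, Fin.snoc_last, sub_smul, one_smul]
  rw [sub_right_comm]

theorem IsFuzzyTorus.snoc_one {δ : ℝ} {T : Fin d → E} (hT : IsFuzzyTorus δ T) :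
    IsGradedFuzzyTorus δ (Fin.snoc T 1 : Fin (d + 1) → E) := by
  have h0 := hT.width_nonneg
  refine ⟨by simp [IsSelfAdjoint.one], h0, hT.width_lt_one, by simp, fun j => ?_, fun j => ?_,
    fun j => ?_, fun j i => ?_⟩
  · refine Fin.lastCases ⟨1, by simp⟩ (fun j => ?_) j
    simpa using hT.invertible j
  · refine Fin.lastCases (by simpa using h0) (fun j => ?_) j
    simpa using hT.norm_mul_star j
  · refine Fin.lastCases (by simpa using h0) (fun j => ?_) j
    simpa using hT.norm_star_mul j
  · refine Fin.lastCases (by simpa using h0) (fun j => ?_) j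
    refine Fin.lastCases (by simpa using h0) (fun i => ?_) i
    simpa using hT.norm_commutator j i

theorem exists_forall_isUnit_interpOp (d : ℕ) :
    ∃ δ₀ : ℝ, 0 < δ₀ ∧ ∀ δ ≤ δ₀, ∀ (E : Type u) [CStarAlgebra E] (T : Fin (d + 1) → E),
      IsGradedFuzzyTorus δ T → ∀ (I : Finset (Fin d)) (n : ℕ)
        (γ : Fin (I.card + 1) → Matrix (Fin n) (Fin n) ℂ), IsIrreducibleClifford γ →
        ∀ r ∈ Set.Icc (0 : ℝ) 1, IsUnit (interpOp T I γ r) := by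
  choose ε hε h using exists_forall_isUnit_cliffordSum.{u}
  -- The bound depends on `I` only through `|I| ≤ d`, so the smallest of finitely many bounds works.
  obtain ⟨k₀, -, hk₀⟩ := Finset.exists_min_image (Finset.range (d + 1)) ε ⟨0, by simp⟩
  refine ⟨ε k₀, hε k₀, fun δ hδ E _ T hT I n γ hγ r hr => ?_⟩
  have hI : I.card ∈ Finset.range (d + 1) := by
    have := I.card_le_univ
    simp only [Fintype.card_fin] at this
    simpa [Nat.lt_succ_iff] using this
  exact h I.card
    { carrier := E
      δ := δ
      r := r
      T := subTorus T I
      H := T (Fin.last d)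
      S := gradingSymm T
      δ_nonneg := hT.2.width_nonneg
      δ_le_one := hT.2.width_lt_one.le
      r_nonneg := hr.1
      r_le_one := hr.2
      norm_mul_star := fun j => hT.2.norm_mul_star _
      norm_star_mul := fun j => hT.2.norm_star_mul _
      norm_commutator := fun j l => hT.2.norm_commutator _ _
      norm_commutator_H := fun j => hT.2.norm_commutator _ _
      norm_sub := hT.norm_sub_symm_le
      isSelfAdjoint_H := hT.1
      isSelfAdjoint_S := hT.isSelfAdjoint_symm
      S_mul_S := hT.symm_mul_symm }
    (hδ.trans (hk₀ _ hI)) n γ hγ _ (interpOp_eq_cliffordSum hT.isStarProjection I γ r)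
    (isSelfAdjoint_interpOp hT I hγ r)

end Interpolation

/-! ### Existence, uniqueness and homotopy invariance of the K-classes -/

section KClasses

variable {E : Type*} [CStarAlgebra E]

theorem K0Unital.mk_eq_of_joinedIn {n : ℕ} {p q : CStarMatrix (Fin n) (Fin n) E}
    (hp : IsStarProjection p) (hq : IsStarProjection q)
    (h : JoinedIn {x : CStarMatrix (Fin n) (Fin n) E | IsStarProjection x} p q) :
    K0Unital.mk p hp = K0Unital.mk q hq := by
  refine (QuotientAddGroup.eq_iff_sub_mem).2 (AddSubgroup.subset_closure ?_)
  exact K0Rel.homotopy ⟨p, hp⟩ ⟨q, hq⟩ h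

theorem K1Unital.mk_eq_of_joinedIn {n : ℕ} {p q : CStarMatrix (Fin n) (Fin n) E}
    (hp : IsUnit p) (hq : IsUnit q)
    (h : JoinedIn {x : CStarMatrix (Fin n) (Fin n) E | IsUnit x} p q) :
    K1Unital.mk p hp = K1Unital.mk q hq := by
  refine (QuotientAddGroup.eq_iff_sub_mem).2 (AddSubgroup.subset_closure ?_)
  exact K1Rel.homotopy ⟨p, hp⟩ ⟨q, hq⟩ h

section Spectral

attribute [local instance] CStarAlgebra.spectralOrder CStarAlgebra.spectralOrderedRing

theorem isStarProjection_matPosProj {n : ℕ} {h : CStarMatrix (Fin n) (Fin n) E} (hu : IsUnit h) :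
    IsStarProjection (matPosProj h) :=
  isStarProjection_posProj hu

theorem joinedIn_matPosProj {n : ℕ} {M : ℝ → CStarMatrix (Fin n) (Fin n) E} (hM : Continuous M)
    (hsa : ∀ t, IsSelfAdjoint (M t)) (hu : ∀ t ∈ Set.Icc (0 : ℝ) 1, IsUnit (M t)) :
    JoinedIn {x : CStarMatrix (Fin n) (Fin n) E | IsStarProjection x}
      (matPosProj (M 0)) (matPosProj (M 1)) := by
  have hc : Continuous fun t : unitInterval => posProj (M t) :=
    continuous_posProj (hM.comp continuous_subtype_val) (fun t => hsa t) (fun t => hu t t.2)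
  exact ⟨⟨⟨fun t => matPosProj (M t), hc⟩, by simp, by simp⟩,
    fun t => isStarProjection_matPosProj (hu t t.2)⟩

end Spectral

theorem existsUnique_isK0UnitalClass {n : ℕ} {h : CStarMatrix (Fin n) (Fin n) E}
    (hsa : IsSelfAdjoint h) (hu : IsUnit h) : ∃! κ : K0Unital E, IsK0UnitalClass h κ :=
  ⟨_, ⟨hsa, hu, isStarProjection_matPosProj hu, rfl⟩, fun _ hκ => hκ.2.2.choose_spec⟩

/-- Oriented to match `interpOp`: `M 1` is `Ĝ_I` and `M 0` the completed restricted operator. -/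
theorem IsK0UnitalClass.of_path {n : ℕ} {M : ℝ → CStarMatrix (Fin n) (Fin n) E}
    (hM : Continuous M) (hsa : ∀ t, IsSelfAdjoint (M t))
    (hu : ∀ t ∈ Set.Icc (0 : ℝ) 1, IsUnit (M t)) {κ : K0Unital E}
    (hκ : IsK0UnitalClass (M 1) κ) : IsK0UnitalClass (M 0) κ := by
  obtain ⟨-, -, hp, rfl⟩ := hκ
  have h0 := hu 0 (by simp)
  exact ⟨hsa 0, h0, isStarProjection_matPosProj h0,
    (K0Unital.mk_eq_of_joinedIn _ _ (joinedIn_matPosProj hM hsa hu)).symm⟩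

section NonUnital

variable {A : Type*} [NonUnitalCStarAlgebra A]

theorem scalarPart_eq_map {n : ℕ} (h : CStarMatrix (Fin n) (Fin n) (Unitization ℂ A)) :
    scalarPart h = h.map ((StarAlgHom.ofId ℂ (Unitization ℂ A)).comp (scalarHom A)) := rfl

theorem isStarProjection_scalarPart {n : ℕ} {p : CStarMatrix (Fin n) (Fin n) (Unitization ℂ A)}
    (hp : IsStarProjection p) : IsStarProjection (scalarPart p) := by
  rw [scalarPart_eq_map]
  exact map_isStarProjection _ hp

/-- Taking scalar parts is a retraction onto `ℂ`, so `p` and its scalar part have the same image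
over `ℂ`. -/
theorem mk_sub_mk_scalarPart_mem_ker {n : ℕ} {p : CStarMatrix (Fin n) (Fin n) (Unitization ℂ A)}
    (hp : IsStarProjection p) :
    K0Unital.mk p hp - K0Unital.mk (scalarPart p) (isStarProjection_scalarPart hp) ∈
      (K0Unital.map (scalarHom A)).ker := by
  rw [AddMonoidHom.mem_ker, map_sub, sub_eq_zero]
  have h : ∀ (q : CStarMatrix (Fin n) (Fin n) (Unitization ℂ A)) (hq : IsStarProjection q),
      K0Unital.map (scalarHom A) (K0Unital.mk q hq) =
        K0Unital.mk (q.map (scalarHom A)) (map_isStarProjection _ hq) := fun q hq => by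
    simp only [K0Unital.map, K0Unital.mk, QuotientAddGroup.map_mk, FreeAbelianGroup.map_of_apply]
    rfl
  rw [h, h]
  congr 1

theorem existsUnique_isK0Class {n : ℕ} {h : CStarMatrix (Fin n) (Fin n) (Unitization ℂ A)}
    (hsa : IsSelfAdjoint h) (hu : IsUnit h) : ∃! κ : K0 A, IsK0Class h κ :=
  ⟨⟨_, mk_sub_mk_scalarPart_mem_ker (isStarProjection_matPosProj hu)⟩,
    ⟨hsa, hu, isStarProjection_matPosProj hu,
      isStarProjection_scalarPart (isStarProjection_matPosProj hu), rfl⟩,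
    fun _ hκ => Subtype.ext hκ.2.2.choose_spec.choose_spec⟩

theorem IsK0Class.of_path {n : ℕ} {M : ℝ → CStarMatrix (Fin n) (Fin n) (Unitization ℂ A)}
    (hM : Continuous M) (hsa : ∀ t, IsSelfAdjoint (M t))
    (hu : ∀ t ∈ Set.Icc (0 : ℝ) 1, IsUnit (M t)) {κ : K0 A}
    (hκ : IsK0Class (M 1) κ) : IsK0Class (M 0) κ := by
  obtain ⟨-, -, hp, hs, hκ⟩ := hκ
  have h0 := hu 0 (by simp)
  have hj := joinedIn_matPosProj hM hsa hu
  refine ⟨hsa 0, h0, isStarProjection_matPosProj h0,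
    isStarProjection_scalarPart (isStarProjection_matPosProj h0), hκ.trans ?_⟩
  congr 1
  · exact (K0Unital.mk_eq_of_joinedIn _ _ hj).symm
  -- The scalar parts are joined by the image of the path of projections under a continuous
  -- ⋆-homomorphism.
  · refine (K0Unital.mk_eq_of_joinedIn _ _ ?_).symm
    refine (hj.map (continuous_map
      ((StarAlgHom.ofId ℂ (Unitization ℂ A)).comp (scalarHom A)) n)).mono ?_
    rintro _ ⟨p, hp, rfl⟩
    exact map_isStarProjection _ hp

end NonUnital

section Compression

variable {n m l : ℕ}

theorem scal_mul_scal {k : ℕ} (M : Matrix (Fin n) (Fin m) ℂ) (N : Matrix (Fin m) (Fin k) ℂ) :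
    scal E M * scal E N = scal E (M * N) := by
  ext i j
  simp [scal, CStarMatrix.mul_apply, CStarMatrix.ofMatrix_apply, Matrix.mul_apply]

theorem scal_one : scal E (1 : Matrix (Fin n) (Fin n) ℂ) = 1 := by
  rw [scal_eq_tens, tens_one_one]

theorem cstarMatrix_mul_assoc {k : ℕ} (a : CStarMatrix (Fin n) (Fin m) E)
    (b : CStarMatrix (Fin m) (Fin l) E) (c : CStarMatrix (Fin l) (Fin k) E) :
    a * b * c = a * (b * c) :=
  Matrix.mul_assoc (α := E) a b c

theorem isUnit_scal {M : Matrix (Fin n) (Fin n) ℂ} (hM : IsUnit M) : IsUnit (scal E M) := by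
  obtain ⟨u, rfl⟩ := hM
  exact ⟨⟨scal E u, scal E ↑u⁻¹, by rw [scal_mul_scal, Units.mul_inv, scal_one],
    by rw [scal_mul_scal, Units.inv_mul, scal_one]⟩, rfl⟩

theorem continuous_scal : Continuous (scal E : Matrix (Fin n) (Fin n) ℂ → _) :=
  Continuous.matrix_map (A := fun p : Matrix (Fin n) (Fin n) ℂ => p) continuous_id
    (continuous_algebraMap ℂ E)

theorem joinedIn_scal_mul_mul_scal {x : CStarMatrix (Fin n) (Fin n) E} (hx : IsUnit x)
    {U V : Matrix (Fin n) (Fin n) ℂ} (hU : IsUnit U) (hV : IsUnit V) :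
    JoinedIn {x : CStarMatrix (Fin n) (Fin n) E | IsUnit x} x (scal E U * x * scal E V) := by
  have h1 := (joinedIn_isUnit_one hU).map
    (f := fun M => scal E M * x) (continuous_scal.matrix_mul continuous_const)
  have h2 := (joinedIn_isUnit_one hV).map
    (f := fun M => scal E U * x * scal E M) (continuous_const.matrix_mul continuous_scal)
  simp only [scal_one, one_mul, mul_one] at h1 h2
  refine (h1.mono ?_).trans (h2.mono ?_)
  · rintro _ ⟨M, hM, rfl⟩; exact (isUnit_scal hM).mul hx
  · rintro _ ⟨M, hM, rfl⟩; exact ((isUnit_scal hU).mul hx).mul (isUnit_scal hM)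

/-- The off-diagonal entry of an invertible matrix anticommuting with a symmetry is invertible. -/
theorem isUnit_compression {Γ : Matrix (Fin n) (Fin n) ℂ} {h : CStarMatrix (Fin n) (Fin n) E}
    (hu : IsUnit h) (ha : scal E Γ * h = -(h * scal E Γ)) {S T : Matrix (Fin n) (Fin m) ℂ}
    (hS : Sᴴ * S = 1) (hT : Tᴴ * T = 1) (h1 : S * Sᴴ + T * Tᴴ = 1) (h2 : S * Sᴴ - T * Tᴴ = Γ) :
    IsUnit (scal E Sᴴ * h * scal E T) := by
  obtain ⟨u, rfl⟩ := hu
  set v : CStarMatrix (Fin n) (Fin n) E := ↑u⁻¹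
  set w : CStarMatrix (Fin n) (Fin n) E := ↑u
  have hwv : w * v = 1 := u.mul_inv
  have hvw : v * w = 1 := u.inv_mul
  have hSS : S * Sᴴ = (1 / 2 : ℂ) • (1 + Γ) := by
    rw [← h1, ← h2]; module
  have hTT : T * Tᴴ = (1 / 2 : ℂ) • (1 - Γ) := by
    rw [← h1, ← h2]; module
  have hlin : ∀ z : ℂ, scal E ((1 / 2 : ℂ) • (1 + z • Γ)) = (1 / 2 : ℂ) • (1 + z • scal E Γ) := by
    intro z
    rw [← scal_one]
    ext i j
    by_cases hij : i = j
    · subst hij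
      simp [scal, CStarMatrix.ofMatrix_apply, Algebra.algebraMap_eq_smul_one, add_smul, smul_smul,
        mul_assoc]
    · simp [scal, CStarMatrix.ofMatrix_apply, Algebra.algebraMap_eq_smul_one, smul_smul, hij,
        mul_assoc]
  -- Anticommuting with `Γ` means interchanging the two eigenprojections; therefore `Tᴴ w⁻¹ S`
  -- inverts `Sᴴ w T`.
  have hcomm : scal E (S * Sᴴ) * w = w * scal E (T * Tᴴ) := by
    have h3 := hlin 1
    have h4 := hlin (-1)
    rw [one_smul, one_smul] at h3
    rw [neg_one_smul, neg_one_smul, ← sub_eq_add_neg, ← sub_eq_add_neg] at h4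
    rw [hSS, hTT, h3, h4, smul_mul_assoc, mul_smul_comm, add_mul, ha, mul_sub, one_mul, mul_one,
      sub_eq_add_neg]
  have hcomm' : scal E (T * Tᴴ) * v = v * scal E (S * Sᴴ) := by
    calc scal E (T * Tᴴ) * v = v * (w * scal E (T * Tᴴ)) * v := by
          rw [← mul_assoc v, hvw, one_mul]
      _ = v * scal E (S * Sᴴ) := by rw [← hcomm, mul_assoc, mul_assoc, hwv, mul_one]
  refine ⟨⟨_, scal E Tᴴ * (v * scal E S), ?_, ?_⟩, rfl⟩
  · calc scal E Sᴴ * w * scal E T * (scal E Tᴴ * (v * scal E S))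
        = scal E Sᴴ * (w * ((scal E T * scal E Tᴴ) * v) * scal E S) := by
          simp only [cstarMatrix_mul_assoc]
      _ = scal E Sᴴ * (scal E (S * Sᴴ) * scal E S) := by
          rw [scal_mul_scal, hcomm', ← mul_assoc, hwv, one_mul]
      _ = 1 := by
          rw [scal_mul_scal, scal_mul_scal, Matrix.mul_assoc, hS, Matrix.mul_one, hS, scal_one]
  · calc scal E Tᴴ * (v * scal E S) * (scal E Sᴴ * w * scal E T)
        = scal E Tᴴ * (v * ((scal E S * scal E Sᴴ) * w) * scal E T) := by
          simp only [cstarMatrix_mul_assoc]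
      _ = scal E Tᴴ * (scal E (T * Tᴴ) * scal E T) := by
          rw [scal_mul_scal, hcomm, ← mul_assoc, hvw, one_mul]
      _ = 1 := by
          rw [scal_mul_scal, scal_mul_scal, Matrix.mul_assoc, hT, Matrix.mul_one, hT, scal_one]

/-- Two isometries with the same range differ by an invertible matrix. -/
theorem exists_isUnit_mul_eq {S S' : Matrix (Fin n) (Fin m) ℂ} (hS : Sᴴ * S = 1)
    (hS' : S'ᴴ * S' = 1) (h : S * Sᴴ = S' * S'ᴴ) :
    ∃ U : Matrix (Fin m) (Fin m) ℂ, IsUnit U ∧ IsUnit Uᴴ ∧ S' = S * U := by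
  have h1 : Sᴴ * S' * (S'ᴴ * S) = 1 := by
    rw [Matrix.mul_assoc, ← Matrix.mul_assoc S', ← h, Matrix.mul_assoc, hS, Matrix.mul_one, hS]
  have h2 : S'ᴴ * S * (Sᴴ * S') = 1 := by
    rw [Matrix.mul_assoc, ← Matrix.mul_assoc S, h, Matrix.mul_assoc, hS', Matrix.mul_one, hS']
  refine ⟨Sᴴ * S', ⟨⟨_, _, h1, h2⟩, rfl⟩, ?_, ?_⟩
  · rw [Matrix.conjTranspose_mul, Matrix.conjTranspose_conjTranspose]
    exact ⟨⟨_, _, h2, h1⟩, rfl⟩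
  · rw [← Matrix.mul_assoc, h, Matrix.mul_assoc, hS', Matrix.mul_one]

theorem two_mul_eq_of_eigenbasis {S T : Matrix (Fin n) (Fin m) ℂ} (hS : Sᴴ * S = 1)
    (hT : Tᴴ * T = 1) (h1 : S * Sᴴ + T * Tᴴ = 1) : m + m = n := by
  have h := congrArg Matrix.trace h1
  rw [Matrix.trace_add, Matrix.trace_mul_comm S, Matrix.trace_mul_comm T, hS, hT] at h
  simp only [Matrix.trace_one, Fintype.card_fin] at h
  exact_mod_cast h

/-- Two eigenbases of `Γ` differ by invertible matrices `U` and `V` on the two eigenspaces, so `x`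
becomes `Uᴴ x V`, and both factors can be moved to `1`. Traces show that the block sizes agree. -/
theorem IsK1Class.unique {Γ : Matrix (Fin n) (Fin n) ℂ} {h : CStarMatrix (Fin n) (Fin n) E}
    {κ κ' : K1Unital E} (hκ : IsK1Class Γ h κ) (hκ' : IsK1Class Γ h κ') : κ' = κ := by
  obtain ⟨-, -, -, m, S, T, hx, hS, hT, h1, h2, rfl⟩ := hκ
  obtain ⟨-, -, -, m', S', T', hx', hS', hT', h1', h2', rfl⟩ := hκ'
  obtain rfl : m = m' := by
    have := two_mul_eq_of_eigenbasis hS hT h1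
    have := two_mul_eq_of_eigenbasis hS' hT' h1'
    omega
  have hSS : S * Sᴴ = S' * S'ᴴ := by
    have : (2 : ℂ) • (S * Sᴴ) = (2 : ℂ) • (S' * S'ᴴ) := by
      calc (2 : ℂ) • (S * Sᴴ) = (S * Sᴴ + T * Tᴴ) + (S * Sᴴ - T * Tᴴ) := by module
        _ = (S' * S'ᴴ + T' * T'ᴴ) + (S' * S'ᴴ - T' * T'ᴴ) := by rw [h1, h2, h1', h2']
        _ = _ := by module
    exact smul_right_injective _ two_ne_zero this
  have hTT : T * Tᴴ = T' * T'ᴴ := by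
    rw [← h1', hSS] at h1; exact add_left_cancel h1
  obtain ⟨U, -, hU, rfl⟩ := exists_isUnit_mul_eq hS hS' hSS
  obtain ⟨V, hV, -, rfl⟩ := exists_isUnit_mul_eq hT hT' hTT
  symm
  apply K1Unital.mk_eq_of_joinedIn
  convert joinedIn_scal_mul_mul_scal hx hU hV using 1
  rw [Matrix.conjTranspose_mul, ← scal_mul_scal, ← scal_mul_scal]
  simp only [cstarMatrix_mul_assoc]

/-- Since `Γ` is constant, one eigenbasis serves the whole path, and the compressions remain
invertible. -/
theorem IsK1Class.of_path {Γ : Matrix (Fin n) (Fin n) ℂ}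
    {M : ℝ → CStarMatrix (Fin n) (Fin n) E} (hM : Continuous M) (hsa : ∀ t, IsSelfAdjoint (M t))
    (hu : ∀ t ∈ Set.Icc (0 : ℝ) 1, IsUnit (M t))
    (ha : ∀ t, scal E Γ * M t = -(M t * scal E Γ)) {κ : K1Unital E}
    (hκ : IsK1Class Γ (M 1) κ) : IsK1Class Γ (M 0) κ := by
  obtain ⟨-, -, -, m, S, T, hx, hS, hT, h1, h2, rfl⟩ := hκ
  have hx' : ∀ t ∈ Set.Icc (0 : ℝ) 1, IsUnit (scal E Sᴴ * M t * scal E T) := fun t ht =>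
    isUnit_compression (hu t ht) (ha t) hS hT h1 h2
  refine ⟨hsa 0, hu 0 (by simp), ha 0, m, S, T, hx' 0 (by simp), hS, hT, h1, h2, ?_⟩
  symm
  apply K1Unital.mk_eq_of_joinedIn
  refine JoinedIn.ofLine (f := fun t => scal E Sᴴ * M t * scal E T) ?_ rfl rfl ?_
  · exact (Continuous.matrix_mul (Continuous.matrix_mul continuous_const hM)
      continuous_const).continuousOn
  · rintro _ ⟨t, ht, rfl⟩
    exact hx' t ht

theorem existsUnique_isK1Class {Γ g : Matrix (Fin n) (Fin n) ℂ} (hΓ : Γ.IsHermitian)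
    (hΓΓ : Γ * Γ = 1) (hg : g.IsHermitian) (hgg : g * g = 1) (hag : Γ * g = -(g * Γ))
    {h : CStarMatrix (Fin n) (Fin n) E} (hsa : IsSelfAdjoint h) (hu : IsUnit h)
    (ha : scal E Γ * h = -(h * scal E Γ)) : ∃! κ : K1Unital E, IsK1Class Γ h κ := by
  obtain ⟨m, S, T, hS, hT, h1, h2⟩ := exists_eigenbasis hΓ hΓΓ hg hgg hag
  have hκ : IsK1Class Γ h (K1Unital.mk _ (isUnit_compression hu ha hS hT h1 h2)) :=
    ⟨hsa, hu, ha, m, S, T, _, hS, hT, h1, h2, rfl⟩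
  exact ⟨_, hκ, fun _ hκ' => hκ.unique hκ'⟩

end Compression

end KClasses

/-! ### Assembly for graded tori and the main theorem -/

section Main

variable {E : Type*} [CStarAlgebra E] {d n : ℕ} {δ : ℝ}

theorem continuous_interpOp (T : Fin (d + 1) → E) (I : Finset (Fin d))
    (γ : Fin (I.card + 1) → Matrix (Fin n) (Fin n) ℂ) : Continuous (interpOp T I γ) := by
  unfold interpOp
  fun_prop

theorem scal_mul_interpOp {T : Fin (d + 1) → E} (hT : IsGradedFuzzyTorus δ T)
    (I : Finset (Fin d)) {γ : Fin (I.card + 1) → Matrix (Fin n) (Fin n) ℂ}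
    {Γ : Matrix (Fin n) (Fin n) ℂ} (hΓ : IsFurtherGenerator γ Γ) (r : ℝ) :
    scal E Γ * interpOp T I γ r = -(interpOp T I γ r * scal E Γ) := by
  rw [interpOp_eq_cliffordSum hT.isStarProjection]
  exact scal_mul_cliffordSum _ hΓ.anticommute

/-- The class in `K₁` of the operators of a graded torus with an odd number of active generators. -/
theorem IsGradedFuzzyTorus.isK1Class {T : Fin (d + 1) → E} (hT : IsGradedFuzzyTorus δ T)
    {I : Finset (Fin d)} {γ : Fin (I.card + 1) → Matrix (Fin n) (Fin n) ℂ}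
    (hγ : IsIrreducibleClifford γ)
    (hu : ∀ r ∈ Set.Icc (0 : ℝ) 1, IsUnit (interpOp T I γ r))
    {Γ : Matrix (Fin n) (Fin n) ℂ} (hΓ : IsFurtherGenerator γ Γ) :
    (∃! κ : K1Unital E, IsK1Class Γ (gHatOp T I γ) κ) ∧
      ∀ κ : K1Unital E, IsK1Class Γ (gHatOp T I γ) κ → IsK1Class Γ (gRestrictedOp T I γ) κ := by
  rw [← interpOp_one, ← interpOp_zero]
  have ha := scal_mul_interpOp hT I hΓ
  have hsa := isSelfAdjoint_interpOp hT I hγ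
  exact ⟨existsUnique_isK1Class hΓ.isHermitian hΓ.sq_eq_one (hγ.isHermitian (Fin.last _))
    (hγ.sq_eq_one _) (hΓ.anticommute _) (hsa 1) (hu 1 (by simp)) (ha 1),
    fun κ hκ => hκ.of_path (continuous_interpOp T I γ) hsa hu ha⟩

theorem IsGradedFuzzyTorus.isK0UnitalClass {T : Fin (d + 1) → E} (hT : IsGradedFuzzyTorus δ T)
    {I : Finset (Fin d)} {γ : Fin (I.card + 1) → Matrix (Fin n) (Fin n) ℂ}
    (hγ : IsIrreducibleClifford γ)
    (hu : ∀ r ∈ Set.Icc (0 : ℝ) 1, IsUnit (interpOp T I γ r)) :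
    (∃! κ : K0Unital E, IsK0UnitalClass (gHatOp T I γ) κ) ∧
      ∀ κ : K0Unital E, IsK0UnitalClass (gHatOp T I γ) κ →
        IsK0UnitalClass (gRestrictedOp T I γ) κ := by
  rw [← interpOp_one, ← interpOp_zero]
  have hsa := isSelfAdjoint_interpOp hT I hγ
  exact ⟨existsUnique_isK0UnitalClass (hsa 1) (hu 1 (by simp)),
    fun κ hκ => hκ.of_path (continuous_interpOp T I γ) hsa hu⟩

theorem IsGradedFuzzyTorus.isK0Class {A : Type*} [NonUnitalCStarAlgebra A]
    {T : Fin (d + 1) → Unitization ℂ A} (hT : IsGradedFuzzyTorus δ T)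
    {I : Finset (Fin d)} {γ : Fin (I.card + 1) → Matrix (Fin n) (Fin n) ℂ}
    (hγ : IsIrreducibleClifford γ)
    (hu : ∀ r ∈ Set.Icc (0 : ℝ) 1, IsUnit (interpOp T I γ r)) :
    (∃! κ : K0 A, IsK0Class (gHatOp T I γ) κ) ∧
      ∀ κ : K0 A, IsK0Class (gHatOp T I γ) κ → IsK0Class (gRestrictedOp T I γ) κ := by
  rw [← interpOp_one, ← interpOp_zero]
  have hsa := isSelfAdjoint_interpOp hT I hγ
  exact ⟨existsUnique_isK0Class (hsa 1) (hu 1 (by simp)),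
    fun κ hκ => hκ.of_path (continuous_interpOp T I γ) hsa hu⟩

end Main

end FuzzyTorus

end

theorem mainTheorem11 (d : ℕ) :
    ∃ δ₀ : ℝ, 0 < δ₀ ∧ ∀ δ : ℝ, δ ≤ δ₀ →
      -- unital C⋆-algebras `A`, tori in `A`
      (∀ (A : Type u) [CStarAlgebra A] (I : Finset (Fin d)) (n : ℕ)
          (γ : Fin (I.card + 1) → Matrix (Fin n) (Fin n) ℂ),
        FuzzyTorus.IsIrreducibleClifford γ →
        (∀ T : Fin d → A, FuzzyTorus.IsFuzzyTorus δ T →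
          (Even I.card →
            ∃! κ : FuzzyTorus.K0Unital A,
              FuzzyTorus.IsK0UnitalClass (FuzzyTorus.gOp 1 T I γ) κ) ∧
          (Odd I.card →
            (∃ Γ, FuzzyTorus.IsFurtherGenerator γ Γ) ∧
            ∀ Γ, FuzzyTorus.IsFurtherGenerator γ Γ →
              ∃! κ : FuzzyTorus.K1Unital A,
                FuzzyTorus.IsK1Class Γ (FuzzyTorus.gOp 1 T I γ) κ)) ∧
        (∀ T : Fin (d + 1) → A, FuzzyTorus.IsGradedFuzzyTorus δ T →
          (IsStarProjection (FuzzyTorus.gradingProj T) ∧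
            FuzzyTorus.IsFuzzyTorusIn (FuzzyTorus.gradingProj T) (6 * δ)
              (FuzzyTorus.restrictedTorus T)) ∧
          (Even I.card →
            (∃! κ : FuzzyTorus.K0Unital A,
              FuzzyTorus.IsK0UnitalClass (FuzzyTorus.gHatOp T I γ) κ) ∧
            ∀ κ : FuzzyTorus.K0Unital A,
              FuzzyTorus.IsK0UnitalClass (FuzzyTorus.gHatOp T I γ) κ →
              FuzzyTorus.IsK0UnitalClass (FuzzyTorus.gRestrictedOp T I γ) κ) ∧
          (Odd I.card →
            (∃ Γ, FuzzyTorus.IsFurtherGenerator γ Γ) ∧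
            ∀ Γ, FuzzyTorus.IsFurtherGenerator γ Γ →
              (∃! κ : FuzzyTorus.K1Unital A,
                FuzzyTorus.IsK1Class Γ (FuzzyTorus.gHatOp T I γ) κ) ∧
              ∀ κ : FuzzyTorus.K1Unital A,
                FuzzyTorus.IsK1Class Γ (FuzzyTorus.gHatOp T I γ) κ →
                FuzzyTorus.IsK1Class Γ (FuzzyTorus.gRestrictedOp T I γ) κ))) ∧
      -- arbitrary C⋆-algebras `A`, tori in the unitization `A^∼ = ℂ ⊕ A`
      (∀ (A : Type u) [NonUnitalCStarAlgebra A] (I : Finset (Fin d)) (n : ℕ)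
          (γ : Fin (I.card + 1) → Matrix (Fin n) (Fin n) ℂ),
        FuzzyTorus.IsIrreducibleClifford γ →
        (∀ T : Fin d → Unitization ℂ A, FuzzyTorus.IsFuzzyTorus δ T →
          (Even I.card →
            ∃! κ : FuzzyTorus.K0 A, FuzzyTorus.IsK0Class (FuzzyTorus.gOp 1 T I γ) κ) ∧
          (Odd I.card →
            (∃ Γ, FuzzyTorus.IsFurtherGenerator γ Γ) ∧
            ∀ Γ, FuzzyTorus.IsFurtherGenerator γ Γ →
              ∃! κ : FuzzyTorus.K1 A,
                FuzzyTorus.IsK1Class Γ (FuzzyTorus.gOp 1 T I γ) κ)) ∧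
        (∀ T : Fin (d + 1) → Unitization ℂ A, FuzzyTorus.IsGradedFuzzyTorus δ T →
          (IsStarProjection (FuzzyTorus.gradingProj T) ∧
            FuzzyTorus.IsFuzzyTorusIn (FuzzyTorus.gradingProj T) (6 * δ)
              (FuzzyTorus.restrictedTorus T)) ∧
          (Even I.card →
            (∃! κ : FuzzyTorus.K0 A, FuzzyTorus.IsK0Class (FuzzyTorus.gHatOp T I γ) κ) ∧
            ∀ κ : FuzzyTorus.K0 A,
              FuzzyTorus.IsK0Class (FuzzyTorus.gHatOp T I γ) κ →
              FuzzyTorus.IsK0Class (FuzzyTorus.gRestrictedOp T I γ) κ) ∧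
          (Odd I.card →
            (∃ Γ, FuzzyTorus.IsFurtherGenerator γ Γ) ∧
            ∀ Γ, FuzzyTorus.IsFurtherGenerator γ Γ →
              (∃! κ : FuzzyTorus.K1 A,
                FuzzyTorus.IsK1Class Γ (FuzzyTorus.gHatOp T I γ) κ) ∧
              ∀ κ : FuzzyTorus.K1 A,
                FuzzyTorus.IsK1Class Γ (FuzzyTorus.gHatOp T I γ) κ →
                FuzzyTorus.IsK1Class Γ (FuzzyTorus.gRestrictedOp T I γ) κ))) := by
  obtain ⟨ε, hε, hu⟩ := FuzzyTorus.exists_forall_isUnit_interpOp.{u} d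
  -- The bound `ε` gives invertibility along the segment, `1/13` the width of the restricted torus.
  refine ⟨min ε (1 / 13), by positivity, fun δ hδ => ⟨?_, ?_⟩⟩
  · intro A _ I n γ hγ
    refine ⟨fun T hT => ?_, fun T hT => ?_⟩
    · have h := hT.snoc_one
      have hU := hu δ (hδ.trans (min_le_left _ _)) A _ h I n γ hγ
      rw [← FuzzyTorus.gHatOp_snoc_one]
      exact ⟨fun _ => (h.isK0UnitalClass hγ hU).1,
        -- There are `|I| + 1` generators, an even number when `|I|` is odd.
        fun hI => ⟨hγ.exists_further hI.add_one, fun Γ hΓ => (h.isK1Class hγ hU hΓ).1⟩⟩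
    · have hU := hu δ (hδ.trans (min_le_left _ _)) A T hT I n γ hγ
      exact ⟨⟨hT.isStarProjection, hT.isFuzzyTorusIn_restricted (hδ.trans (min_le_right _ _))⟩,
        fun _ => hT.isK0UnitalClass hγ hU,
        fun hI => ⟨hγ.exists_further hI.add_one, fun Γ hΓ => hT.isK1Class hγ hU hΓ⟩⟩
  · intro A _ I n γ hγ
    refine ⟨fun T hT => ?_, fun T hT => ?_⟩
    · have h := hT.snoc_one
      have hU := hu δ (hδ.trans (min_le_left _ _)) (Unitization ℂ A) _ h I n γ hγ
      rw [← FuzzyTorus.gHatOp_snoc_one]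
      exact ⟨fun _ => (h.isK0Class hγ hU).1,
        fun hI => ⟨hγ.exists_further hI.add_one, fun Γ hΓ => (h.isK1Class hγ hU hΓ).1⟩⟩
    · have hU := hu δ (hδ.trans (min_le_left _ _)) (Unitization ℂ A) T hT I n γ hγ
      exact ⟨⟨hT.isStarProjection, hT.isFuzzyTorusIn_restricted (hδ.trans (min_le_right _ _))⟩,
        fun _ => hT.isK0Class hγ hU,
        fun hI => ⟨hγ.exists_further hI.add_one, fun Γ hΓ => hT.isK1Class hγ hU hΓ⟩⟩
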